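/- Let $p,q\ge 1$ with $m:=p+q\ge 3$, let $E=\mathbb C^m$ with standard basis $e_1,\dots,e_m$ and standard conjugation $\tau:z\mapsto\bar z$, and let $h(z,w)=\sum_{j\le p}z_j\overline{w_j}-\sum_{j>p}z_j\overline{w_j}$. Put $$G=\{g\in \mathrm{SL}(E): h(gz,gz)=\pm h(z,z)\text{ for all }z\in E\}$$ (one sign for each $g$), let $\mathrm{SU}(p,q)$ be the group of all $g\in\mathrm{SL}(E)$ that preserve $h$, let $\mathfrak g=\mathfrak{su}(p,q)\subset\mathfrak{sl}(E)$ be the real Lie algebra of all traceless $X$ with $h(Xz,w)+h(z,Xw)=0$ for all $z,w\in E$, and let $\mathfrak g^{-\tau}=\{X\in\mathfrak g:\tau X\tau=-X\}$. A *qualifying MASA* is a maximal abelian real Lie subalgebra $\mathfrak v$ of $\mathfrak g$ such that $g\mathfrak vg^{-1}\subset\mathfrak g^{-\tau}$ for some $g\in G$. Its *toral part* $\mathfrak v^{\rm red}$ is the set of all elements of $\mathfrak v$ that are semisimple endomorphisms of $E$, and $C_{\mathfrak g}(\mathfrak v^{\rm red})$ denotes the centralizer of $\mathfrak v^{\rm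 red}$ in $\mathfrak g$. Let $E=\bigoplus_{\chi\in\mathcal J}E_\chi$, $E_\chi\neq 0$, be the decomposition of $E$ into the joint eigenspaces of $\mathfrak v^{\rm red}$, with $\chi:\mathfrak v^{\rm red}\to\mathbb C$, and let $\chi\mapsto\bar\chi:=-\overline{\chi(\cdot)}$ be the induced involution of $\mathcal J$ (if $\mathfrak v\subset\mathfrak g^{-\tau}$ then $E_{\bar\chi}=\tau(E_\chi)$). Write $\mathcal J=\mathcal K\sqcup\mathcal L\sqcup\overline{\mathcal L}$ with $\mathcal K=\{\chi\in\mathcal J:\bar\chi=\chi\}$. The *$D$-invariant* of $\mathfrak v$ is the formal sum $$D(\mathfrak v)=\sum_{\chi\in\mathcal K}1\cdot(p_\chi,q_\chi)+\sum_{\chi\in\mathcal L}1\cdot \mathbf m_\chi$$ in the free commutative monoid over the disjoint union of $\mathbb N^2$ and $\mathbb N$, where $(p_\chi,q_\chi)\in\mathbb N^2$ is the type of the hermitian form $h|_{E_\chi}$ and $\mathbf m_\chi=\dim E_\chi\in\mathbb N$. The involution $D\mapsto D^{\rm opp}$ of this monoid is induced by $(s,t)\mapsto(t,s)$ on $\mathbb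 N^2$ and the identity on $\mathbb N$. **Proposition.** Let $\mathfrak v_1,\mathfrak v_2$ be two qualifying MASAs in $\mathfrak g=\mathfrak{su}(p,q)$. 1. The toral parts $\mathfrak v_1^{\rm red},\mathfrak v_2^{\rm red}$ are conjugate under $\mathrm{SU}(p,q)$ if and only if $D(\mathfrak v_1)=D(\mathfrak v_2)$. Likewise, the centralizers $C_{\mathfrak g}(\mathfrak v_1^{\rm red}),C_{\mathfrak g}(\mathfrak v_2^{\rm red})$ are conjugate under $\mathrm{SU}(p,q)$ if and only if $D(\mathfrak v_1)=D(\mathfrak v_2)$. 2. If $p=q$, then $\mathrm{SU}(p,q)$ is a subgroup of index two in $G$, and the toral parts $\mathfrak v_1^{\rm red},\mathfrak v_2^{\rm red}$ are $G$-conjugate if and only if $D(\mathfrak v_1)=D(\mathfrak v_2)$ or $D(\mathfrak v_1)=D(\mathfrak v_2)^{\rm opp}$. -/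

import Mathlib

open scoped Matrix

attribute [local instance 100] LieRing.ofAssociativeRing

namespace SUpq

/-- The coordinate space `E = ℂ^m`, `m = p + q`, with standard basis `e_1, …, e_m`. -/
abbrev E (p q : ℕ) : Type := Fin p ⊕ Fin q → ℂ

/-- Complex `m × m` matrices, i.e. endomorphisms of `E`. -/
abbrev Mat (p q : ℕ) : Type := Matrix (Fin p ⊕ Fin q) (Fin p ⊕ Fin q) ℂ

/-- The group `L = SL(E)`. -/
abbrev SL (p q : ℕ) : Type := Matrix.SpecialLinearGroup (Fin p ⊕ Fin q) ℂ

/-- The hermitian form of type `(p, q)`, linear in the first and antilinear in the second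
variable, with `h(e_j, e_k) = ± δ_{jk}` (plus for the first `p` indices, minus for the others). -/
def herm (p q : ℕ) (z w : E p q) : ℂ :=
  (∑ j : Fin p, z (Sum.inl j) * star (w (Sum.inl j)))
    - ∑ j : Fin q, z (Sum.inr j) * star (w (Sum.inr j))

lemma herm_add_left {p q : ℕ} (a b w : E p q) :
    herm p q (a + b) w = herm p q a w + herm p q b w := by
  simp [herm, add_mul, Finset.sum_add_distrib]; ring

lemma herm_add_right {p q : ℕ} (a b w : E p q) :
    herm p q w (a + b) = herm p q w a + herm p q w b := by
  simp [herm, mul_add, Finset.sum_add_distrib]; ring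

lemma herm_neg_left {p q : ℕ} (a w : E p q) : herm p q (-a) w = - herm p q a w := by
  simp [herm]; ring

lemma herm_neg_right {p q : ℕ} (a w : E p q) : herm p q w (-a) = - herm p q w a := by
  simp [herm]; ring

lemma herm_smul_left {p q : ℕ} (c : ℝ) (a w : E p q) :
    herm p q (c • a) w = c * herm p q a w := by
  simp [herm, mul_sub, Finset.mul_sum, mul_assoc]

lemma herm_smul_right {p q : ℕ} (c : ℝ) (a w : E p q) :
    herm p q w (c • a) = c * herm p q w a := by
  simp [herm, mul_sub, Finset.mul_sum, mul_left_comm]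

/-- The real Lie algebra `𝔤 = 𝔰𝔲(p,q)`. -/
def su (p q : ℕ) : LieSubalgebra ℝ (Mat p q) where
  carrier := {X | X.trace = 0 ∧
    ∀ z w : E p q, herm p q (X *ᵥ z) w + herm p q z (X *ᵥ w) = 0}
  zero_mem' := ⟨by simp, fun z w => by simp [herm]⟩
  add_mem' := by
    rintro X Y ⟨hX, hX'⟩ ⟨hY, hY'⟩
    refine ⟨by simp [hX, hY], fun z w => ?_⟩
    rw [Matrix.add_mulVec, Matrix.add_mulVec, herm_add_left, herm_add_right]
    linear_combination hX' z w + hY' z w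
  smul_mem' := by
    rintro c X ⟨hX, hX'⟩
    refine ⟨by simp [hX], fun z w => ?_⟩
    rw [Matrix.smul_mulVec, Matrix.smul_mulVec, herm_smul_left, herm_smul_right]
    linear_combination (c : ℂ) * hX' z w
  lie_mem' := by
    rintro X Y ⟨hX, hX'⟩ ⟨hY, hY'⟩
    refine ⟨by simp [Ring.lie_def, Matrix.trace_mul_comm X Y], fun z w => ?_⟩
    rw [Ring.lie_def, Matrix.sub_mulVec, Matrix.sub_mulVec, sub_eq_add_neg, sub_eq_add_neg,
      herm_add_left, herm_add_right, herm_neg_left, herm_neg_right]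
    simp only [← Matrix.mulVec_mulVec]
    linear_combination hX' (Y *ᵥ z) w - hY' (X *ᵥ z) w + hX' z (Y *ᵥ w) - hY' z (X *ᵥ w)

/-- `𝔤^{-τ}`: the elements of `𝔤` with `τ X τ = -X`, where `τ` is the standard conjugation
`z ↦ z̄` of `E`; on matrices `τ X τ` is the entrywise conjugate of `X`. -/
def suMinus (p q : ℕ) : Set (Mat p q) := {X | X ∈ su p q ∧ X.map star = -X}

/-- The group `G⁰ = SU(p,q)`. -/
def SU (p q : ℕ) : Subgroup (SL p q) where
  carrier := {g | ∀ z w : E p q, herm p q ((g : Mat p q) *ᵥ z) ((g : Mat p q) *ᵥ w) = herm p q z w}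
  one_mem' := fun z w => by simp
  mul_mem' := by
    intro a b ha hb z w
    rw [Matrix.SpecialLinearGroup.coe_mul, ← Matrix.mulVec_mulVec, ← Matrix.mulVec_mulVec, ha, hb]
  inv_mem' := by
    intro a ha z w
    have key : ∀ v : E p q, (a : Mat p q) *ᵥ (((a⁻¹ : SL p q) : Mat p q) *ᵥ v) = v := fun v => by
      rw [Matrix.mulVec_mulVec, ← Matrix.SpecialLinearGroup.coe_mul, mul_inv_cancel,
        Matrix.SpecialLinearGroup.coe_one, Matrix.one_mulVec]
    have := ha (((a⁻¹ : SL p q) : Mat p q) *ᵥ z) (((a⁻¹ : SL p q) : Mat p q) *ᵥ w)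
    rw [key, key] at this
    exact this.symm

/-- The group `G` of all `g ∈ SL(E)` with `h(gz, gz) = ± h(z, z)` for all `z`. -/
def G (p q : ℕ) : Subgroup (SL p q) where
  carrier := {g |
    (∀ z : E p q, herm p q ((g : Mat p q) *ᵥ z) ((g : Mat p q) *ᵥ z) = herm p q z z) ∨
    (∀ z : E p q, herm p q ((g : Mat p q) *ᵥ z) ((g : Mat p q) *ᵥ z) = - herm p q z z)}
  one_mem' := Or.inl fun z => by simp
  mul_mem' := by
    rintro a b (ha | ha) (hb | hb)
    · left; intro z
      rw [Matrix.SpecialLinearGroup.coe_mul, ← Matrix.mulVec_mulVec, ha, hb]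
    · right; intro z
      rw [Matrix.SpecialLinearGroup.coe_mul, ← Matrix.mulVec_mulVec, ha, hb]
    · right; intro z
      rw [Matrix.SpecialLinearGroup.coe_mul, ← Matrix.mulVec_mulVec, ha, hb]
    · left; intro z
      rw [Matrix.SpecialLinearGroup.coe_mul, ← Matrix.mulVec_mulVec, ha, hb, neg_neg]
  inv_mem' := by
    intro a ha
    have key : ∀ v : E p q, (a : Mat p q) *ᵥ (((a⁻¹ : SL p q) : Mat p q) *ᵥ v) = v := fun v => by
      rw [Matrix.mulVec_mulVec, ← Matrix.SpecialLinearGroup.coe_mul, mul_inv_cancel,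
        Matrix.SpecialLinearGroup.coe_one, Matrix.one_mulVec]
    rcases ha with ha | ha
    · left; intro z
      have := ha (((a⁻¹ : SL p q) : Mat p q) *ᵥ z)
      rw [key] at this
      exact this.symm
    · right; intro z
      have := ha (((a⁻¹ : SL p q) : Mat p q) *ᵥ z)
      rw [key] at this
      rw [this, neg_neg]

/-- `Ad(g) X = g X g⁻¹`. -/
def Ad {p q : ℕ} (g : SL p q) (X : Mat p q) : Mat p q :=
  (g : Mat p q) * X * ((g⁻¹ : SL p q) : Mat p q)

/-- Two sets of endomorphisms are conjugate under the subgroup `H` of `SL(E)`. -/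
def ConjUnder {p q : ℕ} (H : Subgroup (SL p q)) (A B : Set (Mat p q)) : Prop :=
  ∃ g ∈ H, Ad g '' A = B

/-- A MASA of `𝔤 = 𝔰𝔲(p,q)`: a maximal abelian real Lie subalgebra. -/
def IsMASA {p q : ℕ} (v : LieSubalgebra ℝ (Mat p q)) : Prop :=
  Maximal (fun w : LieSubalgebra ℝ (Mat p q) => w ≤ su p q ∧ IsLieAbelian w) v

/-- A qualifying MASA of `𝔤`: a MASA that some `Ad(g)`, `g ∈ G`, maps into `𝔤^{-τ}`. -/
def IsQualifyingMASA {p q : ℕ} (v : LieSubalgebra ℝ (Mat p q)) : Prop :=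
  IsMASA v ∧ ∃ g ∈ G p q, ∀ X ∈ v, Ad g X ∈ suMinus p q

/-- The toral part of `v`: its elements that are semisimple endomorphisms of `E`. -/
def toralPart {p q : ℕ} (v : LieSubalgebra ℝ (Mat p q)) : Set (Mat p q) :=
  {X | X ∈ v ∧ Module.End.IsSemisimple (Matrix.toLin' X)}

/-- The centralizer in `𝔤` of a set of endomorphisms. -/
def suCentralizer {p q : ℕ} (A : Set (Mat p q)) : Set (Mat p q) :=
  {X | X ∈ su p q ∧ ∀ Y ∈ A, ⁅X, Y⁆ = 0}

/-- The joint eigenspace `E_χ` of a set `A` of endomorphisms for a function `χ : A → ℂ`. -/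
def jointEigenspace {p q : ℕ} (A : Set (Mat p q)) (χ : A → ℂ) : Submodule ℂ (E p q) :=
  ⨅ X : A, Module.End.eigenspace (Matrix.toLin' X.1) (χ X)

/-- The index set `𝒥` of the decomposition of `E` into joint eigenspaces of the toral part of
`v`: the functions `χ` with `E_χ ≠ 0`. -/
def weights {p q : ℕ} (v : LieSubalgebra ℝ (Mat p q)) : Set (toralPart v → ℂ) :=
  {χ | jointEigenspace (toralPart v) χ ≠ ⊥}

/-- The involution `χ ↦ χ̄` of the index set, `χ̄(X) = - conj (χ(X))`. If `v` lies in `𝔤^{-τ}`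
then `E_χ̄ = τ(E_χ)`, see `mem_jointEigenspace_bar`. -/
def bar {p q : ℕ} {v : LieSubalgebra ℝ (Mat p q)} (χ : toralPart v → ℂ) : toralPart v → ℂ :=
  fun X => - star (χ X)

/-- The index set `𝒦` of the joint eigenspaces with `χ̄ = χ`. -/
def weightsK {p q : ℕ} (v : LieSubalgebra ℝ (Mat p q)) : Set (toralPart v → ℂ) :=
  {χ | χ ∈ weights v ∧ bar χ = χ}

/-- A set `ℒ` that contains exactly one element of every pair `{χ, χ̄}`, `χ̄ ≠ χ`, of indices: the
smaller one in an arbitrary well-order of all functions (so that `𝒥` is the disjoint union of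
`𝒦`, `ℒ` and the image of `ℒ` under the involution). -/
def weightsL {p q : ℕ} (v : LieSubalgebra ℝ (Mat p q)) : Set (toralPart v → ℂ) :=
  {χ | χ ∈ weights v ∧ WellOrderingRel χ (bar χ)}

/-- The positive index of `h` on `W`: the maximal dimension of a subspace of `W` on which `h` is
positive definite. -/
noncomputable def posIndex {p q : ℕ} (W : Submodule ℂ (E p q)) : ℕ :=
  sSup {n | ∃ V ≤ W, Module.finrank ℂ V = n ∧ ∀ z ∈ V, z ≠ 0 → 0 < (herm p q z z).re}

/-- The negative index of `h` on `W`. -/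
noncomputable def negIndex {p q : ℕ} (W : Submodule ℂ (E p q)) : ℕ :=
  sSup {n | ∃ V ≤ W, Module.finrank ℂ V = n ∧ ∀ z ∈ V, z ≠ 0 → (herm p q z z).re < 0}

/-- The free commutative monoid over the disjoint union of `ℕ × ℕ` (types of hermitian forms) and
`ℕ` (dimensions). It contains the free commutative monoid over the disjoint union of
`{(s, t) | st = 0 → s + t = 1}` and `{n | n ≠ 0}`, in which the invariants of qualifying MASAs
lie. -/
abbrev DMonoid : Type := ((ℕ × ℕ) ⊕ ℕ) →₀ ℕ

/-- The involution of `DMonoid` induced by `(s, t) ↦ (t, s)` and the identity of `ℕ`. -/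
noncomputable def DMonoid.opp (D : DMonoid) : DMonoid :=
  Finsupp.mapDomain (Sum.map Prod.swap id) D

/-- The `D`-invariant of `v`: the sum of `1·(p_χ, q_χ)` over `χ ∈ 𝒦`, where `(p_χ, q_χ)` is the
type of `h` on `E_χ`, and of `1·m_χ` over `χ ∈ ℒ`, where `m_χ = dim E_χ`. (The sums are finite, see
`weights_finite`.) -/
noncomputable def DInvariant {p q : ℕ} (v : LieSubalgebra ℝ (Mat p q)) : DMonoid :=
  (∑ᶠ χ ∈ weightsK v, Finsupp.single (Sum.inl
      (posIndex (jointEigenspace (toralPart v) χ), negIndex (jointEigenspace (toralPart v) χ))) 1)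
  + ∑ᶠ χ ∈ weightsL v, Finsupp.single (Sum.inr
      (Module.finrank ℂ (jointEigenspace (toralPart v) χ))) 1

lemma mem_jointEigenspace {p q : ℕ} {A : Set (Mat p q)} {χ : A → ℂ} {z : E p q} :
    z ∈ jointEigenspace A χ ↔ ∀ X : A, X.1 *ᵥ z = χ X • z := by
  simp [jointEigenspace]

/-- If `v` lies in `𝔤^{-τ}` then `τ(E_χ) = E_χ̄`. -/
lemma mem_jointEigenspace_bar {p q : ℕ} {v : LieSubalgebra ℝ (Mat p q)}
    (hv : ∀ X ∈ v, X ∈ suMinus p q) (χ : toralPart v → ℂ) (z : E p q) :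
    star z ∈ jointEigenspace (toralPart v) (bar χ) ↔ z ∈ jointEigenspace (toralPart v) χ := by
  rw [mem_jointEigenspace, mem_jointEigenspace]
  refine forall_congr' fun X => ?_
  have h1 : X.1 = -(X.1.map star) := by rw [(hv _ X.2.1).2, neg_neg]
  have h2 : X.1 *ᵥ star z = - star (X.1 *ᵥ z) := by
    conv_lhs => rw [h1]
    rw [Matrix.neg_mulVec]
    congr 1
    ext i
    simp [Matrix.mulVec, dotProduct]
  have h3 : bar χ X • star z = - star (χ X • z) := by
    ext i
    simp [bar]
  rw [h2, h3, neg_inj, star_inj]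

/-- The involution `χ ↦ χ̄` is the pairing of joint eigenspaces given by `h`: if `ψ ≠ χ̄`
then `E_χ` and `E_ψ` are `h`-orthogonal. -/
lemma herm_eq_zero_of_ne_bar {p q : ℕ} {v : LieSubalgebra ℝ (Mat p q)} (hv : v ≤ su p q)
    {χ ψ : toralPart v → ℂ} (h : ψ ≠ bar χ) {z w : E p q}
    (hz : z ∈ jointEigenspace (toralPart v) χ) (hw : w ∈ jointEigenspace (toralPart v) ψ) :
    herm p q z w = 0 := by
  obtain ⟨X, hX⟩ := Function.ne_iff.1 h
  have h1 := (hv X.2.1).2 z w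
  rw [mem_jointEigenspace.1 hz X, mem_jointEigenspace.1 hw X] at h1
  have h2 : (χ X + star (ψ X)) * herm p q z w = 0 := by
    rw [← h1]
    simp only [herm, Pi.smul_apply, smul_eq_mul, star_mul', mul_sub, Finset.mul_sum, add_mul]
    simp only [mul_left_comm, mul_assoc, Finset.sum_add_distrib]
    ring
  rcases mul_eq_zero.1 h2 with h3 | h3
  · refine absurd ?_ hX
    have := congrArg star h3
    simp only [star_add, star_star, star_zero] at this
    simp only [bar]
    linear_combination this
  · exact h3

/-- Every index lies in `𝒦`, in `ℒ`, or is mapped into `ℒ` by the involution as soon as that image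
is an index. -/
lemma weights_cases {p q : ℕ} {v : LieSubalgebra ℝ (Mat p q)} {χ : toralPart v → ℂ}
    (h : χ ∈ weights v) (h' : bar χ ∈ weights v) :
    χ ∈ weightsK v ∨ χ ∈ weightsL v ∨ bar χ ∈ weightsL v := by
  have hb : bar (bar χ) = χ := by funext X; simp [bar]
  rcases trichotomous_of WellOrderingRel χ (bar χ) with h1 | h1 | h1
  · exact Or.inr (Or.inl ⟨h, h1⟩)
  · exact Or.inl ⟨h, h1.symm⟩
  · exact Or.inr (Or.inr ⟨h', by rwa [hb]⟩)

/-- There are only finitely many joint eigenspaces. -/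
lemma weights_finite {p q : ℕ} {v : LieSubalgebra ℝ (Mat p q)} (hv : IsLieAbelian v) :
    (weights v).Finite := by
  have hc : ∀ X Y : toralPart v, Commute (Matrix.toLin' X.1) (Matrix.toLin' Y.1) := by
    intro X Y
    have h0 : ⁅(⟨X.1, X.2.1⟩ : v), (⟨Y.1, Y.2.1⟩ : v)⁆ = 0 := hv.trivial _ _
    have h1 : ⁅X.1, Y.1⁆ = 0 := congrArg Subtype.val h0
    rw [Ring.lie_def, sub_eq_zero] at h1
    simp only [Commute, SemiconjBy, Module.End.mul_eq_comp, ← Matrix.toLin'_mul, h1]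
  have ind := Module.End.independent_iInf_maxGenEigenspace_of_forall_mapsTo
    (fun X : toralPart v => Matrix.toLin' X.1)
    (fun X Y φ => Module.End.mapsTo_maxGenEigenspace_of_comm (hc Y X) φ)
  have ind' : iSupIndep (jointEigenspace (toralPart v)) :=
    ind.mono fun χ => iInf_mono fun X =>
      (Module.End.eigenspace_le_maxGenEigenspace)
  exact WellFoundedGT.finite_ne_bot_of_iSupIndep ind'

end SUpq

/-! ### Sesquilinear algebra: polarization and the adjoint for `herm` -/

namespace SUpq

variable {p q : ℕ}

/-! The toral part `t` of a MASA `v` is a commuting family of semisimple endomorphisms, so `E` is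
the direct sum of its joint eigenspaces `E_χ`. The form pairs `E_χ` perfectly with `E_χ̄` and makes
it orthogonal to all the others (`pairsLeft_jointEigenspace`). Maximality of `v` shows that `t` is
recovered from the unlabelled decomposition: it is the set of all elements of `su p q` that are
scalar on each `E_χ` (`mem_toralPart_iff`). Conjugating toral parts therefore amounts to moving one
decomposition onto the other by a map compatible with the form.

Such a map exists exactly when the pieces match. A piece with `χ̄ = χ` is a nondegenerate hermitian
space, classified by its signature (`SignedOrthonormal.index_eq`, `exists_isometry`). A pair `{χ,
χ̄}` with `χ̄ ≠ χ` is a dual pair of subspaces, classified by dimension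
(`exists_isometry_of_pairs`). Equal invariants give a matching of the pieces, the piecewise maps
glue (`exists_isometry_of_DInvariant`), and a unimodular scalar brings the determinant to 1
(`exists_similitude_smul`). Conversely, conjugation transports weights, commutes with the involution
and preserves types (`DInvariant_apply_of_similitude`).

Everything is done for maps that multiply the form by a sign `ε`. The value 1 gives `SU`; the value
-1 exchanges positive and negative indices, which produces `opp` and the statement for `G`. The
claim on centralizers reduces to the one on toral parts, because `t` is the centre of its own
centralizer (`mem_toralPart_iff_center`). -/

lemma herm_smul_left' (c : ℂ) (a w : E p q) : herm p q (c • a) w = c * herm p q a w := by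
  simp [herm, mul_sub, Finset.mul_sum, mul_assoc]

lemma herm_smul_right' (c : ℂ) (a w : E p q) :
    herm p q w (c • a) = star c * herm p q w a := by
  simp [herm, mul_sub, Finset.mul_sum, mul_left_comm]

lemma herm_star (z w : E p q) : star (herm p q z w) = herm p q w z := by
  simp [herm, mul_comm]

lemma herm_self_im (z : E p q) : (herm p q z z).im = 0 := by
  have := congrArg Complex.im (herm_star z z)
  simp at this
  linarith

lemma herm_self (z : E p q) : herm p q z z = ((herm p q z z).re : ℂ) :=
  Complex.ext rfl (by simpa using herm_self_im z)

/-- The hermitian form as a sesquilinear map. -/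
noncomputable def hermForm (p q : ℕ) : E p q →ₗ[ℂ] E p q →ₗ⋆[ℂ] ℂ :=
  LinearMap.mk₂'ₛₗ (RingHom.id ℂ) (starRingEnd ℂ) (herm p q)
    (fun _ _ _ => herm_add_left _ _ _) (fun _ _ _ => herm_smul_left' _ _ _)
    (fun _ _ _ => herm_add_right _ _ _) (fun _ _ _ => herm_smul_right' _ _ _)

@[simp] lemma hermForm_apply (z w : E p q) : hermForm p q z w = herm p q z w := rfl

@[simp] lemma herm_zero_left (z : E p q) : herm p q 0 z = 0 := by simp [herm]

@[simp] lemma herm_zero_right (z : E p q) : herm p q z 0 = 0 := by simp [herm]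

lemma herm_sum_left {ι : Type*} (s : Finset ι) (f : ι → E p q) (w : E p q) :
    herm p q (∑ i ∈ s, f i) w = ∑ i ∈ s, herm p q (f i) w := by
  simp only [← hermForm_apply, map_sum, LinearMap.sum_apply]

lemma herm_sum_right {ι : Type*} (s : Finset ι) (f : ι → E p q) (w : E p q) :
    herm p q w (∑ i ∈ s, f i) = ∑ i ∈ s, herm p q w (f i) := by
  simp only [← hermForm_apply, map_sum]

lemma herm_sub_left (a b w : E p q) : herm p q (a - b) w = herm p q a w - herm p q b w := by
  simp only [← hermForm_apply, map_sub, LinearMap.sub_apply]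

lemma herm_sub_right (a b w : E p q) : herm p q w (a - b) = herm p q w a - herm p q w b := by
  simp only [← hermForm_apply, map_sub]

lemma eq_zero_of_herm_eq_zero {z : E p q} (h : ∀ w, herm p q z w = 0) : z = 0 := by
  ext (i | i)
  · simpa [herm, Pi.single_apply, apply_ite] using h (Pi.single (Sum.inl i) 1)
  · simpa [herm, Pi.single_apply, apply_ite] using h (Pi.single (Sum.inr i) 1)

lemma herm_eq_zero_comm {z w : E p q} : herm p q z w = 0 ↔ herm p q w z = 0 := by
  rw [← herm_star w z, star_eq_zero]

/-- Polarization. -/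
lemma herm_polarization (z w : E p q) :
    4 * herm p q z w = herm p q (z + w) (z + w) - herm p q (z - w) (z - w)
      + Complex.I * herm p q (z + Complex.I • w) (z + Complex.I • w)
      - Complex.I * herm p q (z - Complex.I • w) (z - Complex.I • w) := by
  simp only [herm_add_left, herm_add_right, herm_sub_left, herm_sub_right, herm_smul_left',
    herm_smul_right']
  simp only [RCLike.star_def, Complex.conj_I]
  linear_combination (2 * herm p q z w - 2 * herm p q w z) * Complex.I_sq

/-- Polarization. It turns the condition on `h(z, z)` that defines `G` into a condition on all pairs
of vectors. -/
lemma herm_eq_of_self {ε : ℝ} (f : E p q →ₗ[ℂ] E p q)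
    (h : ∀ z, herm p q (f z) (f z) = ε * herm p q z z) (z w : E p q) :
    herm p q (f z) (f w) = ε * herm p q z w := by
  have h1 := herm_polarization (f z) (f w)
  have h2 := herm_polarization z w
  rw [← map_smul, ← map_add, ← map_add, ← map_sub, ← map_sub, h, h, h, h] at h1
  linear_combination (1 / 4 : ℂ) * h1 - (ε / 4 : ℂ) * h2

/-- The diagonal matrix of the hermitian form. -/
def hermMatrix (p q : ℕ) : Mat p q := Matrix.diagonal (Sum.elim (fun _ => 1) (fun _ => -1))

lemma herm_eq_dotProduct (z w : E p q) : herm p q z w = star w ⬝ᵥ (hermMatrix p q *ᵥ z) := by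
  simp [herm, hermMatrix, dotProduct, Matrix.mulVec_diagonal, sub_eq_add_neg, mul_comm]

lemma hermMatrix_mul_self : hermMatrix p q * hermMatrix p q = 1 := by
  rw [hermMatrix, Matrix.diagonal_mul_diagonal, ← Matrix.diagonal_one]
  congr 1
  ext (i | i) <;> simp

lemma hermMatrix_conjTranspose : (hermMatrix p q)ᴴ = hermMatrix p q := by
  rw [hermMatrix, Matrix.diagonal_conjTranspose]
  congr 1
  ext (i | i) <;> simp

/-- The adjoint of an endomorphism with respect to the hermitian form. -/
def hermAdj (X : Mat p q) : Mat p q := hermMatrix p q * Xᴴ * hermMatrix p q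

lemma herm_hermAdj (X : Mat p q) (z w : E p q) :
    herm p q z (hermAdj X *ᵥ w) = herm p q (X *ᵥ z) w := by
  rw [herm_eq_dotProduct, herm_eq_dotProduct, Matrix.star_mulVec, ← Matrix.dotProduct_mulVec,
    hermAdj, Matrix.conjTranspose_mul, Matrix.conjTranspose_mul, Matrix.conjTranspose_conjTranspose,
    hermMatrix_conjTranspose, Matrix.mulVec_mulVec, Matrix.mul_assoc, Matrix.mul_assoc,
    hermMatrix_mul_self, Matrix.mul_one, ← Matrix.mulVec_mulVec]

lemma trace_hermAdj (X : Mat p q) : (hermAdj X).trace = star X.trace := by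
  rw [hermAdj, Matrix.trace_mul_comm, ← Matrix.mul_assoc, hermMatrix_mul_self, Matrix.one_mul,
    Matrix.trace_conjTranspose]

lemma eq_of_herm_mulVec {X Y : Mat p q}
    (h : ∀ z w, herm p q (X *ᵥ z) w = herm p q (Y *ᵥ z) w) : X = Y := by
  refine Matrix.mulVec_injective (funext fun z => ?_)
  refine sub_eq_zero.1 (eq_zero_of_herm_eq_zero fun w => ?_)
  rw [herm_sub_left, h, sub_self]

lemma herm_hermAdj' (X : Mat p q) (z w : E p q) :
    herm p q (hermAdj X *ᵥ z) w = herm p q z (X *ᵥ w) := by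
  rw [← herm_star, herm_hermAdj, herm_star]

/-- Here and in the next lemma a traceless matrix is split into its skew and self-adjoint parts:
`𝔰𝔩(E) = 𝔤 ⊕ i𝔤`. This lets statements about the real algebra be tested on complex matrices. -/
lemma sub_hermAdj_mem_su {X : Mat p q} (h : X.trace = 0) : X - hermAdj X ∈ su p q := by
  refine ⟨by rw [Matrix.trace_sub, trace_hermAdj, h]; simp, fun z w => ?_⟩
  rw [Matrix.sub_mulVec, Matrix.sub_mulVec, herm_sub_left, herm_sub_right, herm_hermAdj,
    herm_hermAdj']
  ring

lemma I_smul_add_hermAdj_mem_su {X : Mat p q} (h : X.trace = 0) :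
    Complex.I • (X + hermAdj X) ∈ su p q := by
  refine ⟨by rw [Matrix.trace_smul, Matrix.trace_add, trace_hermAdj, h]; simp, fun z w => ?_⟩
  rw [Matrix.smul_mulVec, Matrix.smul_mulVec, Matrix.add_mulVec, Matrix.add_mulVec,
    herm_smul_left', herm_smul_right', herm_add_left, herm_add_right, herm_hermAdj,
    herm_hermAdj', RCLike.star_def, Complex.conj_I]
  ring

/-- If `X` commutes with an element of `𝔤`, so does its adjoint. -/
lemma commute_hermAdj {X Y : Mat p q} (hY : Y ∈ su p q) (h : Commute X Y) :
    Commute (hermAdj X) Y := by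
  refine eq_of_herm_mulVec fun z w => ?_
  have h1 := fun z => congrArg (· *ᵥ z) h.eq
  simp only [← Matrix.mulVec_mulVec] at h1 ⊢
  have h2 := hY.2 z (X *ᵥ w)
  have h3 := hY.2 (hermAdj X *ᵥ z) w
  rw [herm_hermAdj'] at h3 ⊢
  rw [h1] at h3
  linear_combination h2 - h3

end SUpq

/-! ### Sylvester's law, isometries of nondegenerate subspaces and of dual pairs -/

namespace SUpq

variable {p q : ℕ}

/-- The hermitian form pairs `A` and `B` without left kernel. -/
def PairsLeft (A B : Submodule ℂ (E p q)) : Prop :=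
  ∀ z ∈ A, (∀ w ∈ B, herm p q z w = 0) → z = 0

/-- `b` is orthogonal for the hermitian form, with signs `s`. -/
structure SignedOrthonormal {ι : Type*} [DecidableEq ι] (b : ι → E p q) (s : ι → ℝ) : Prop where
  sign : ∀ i, s i = 1 ∨ s i = -1
  herm : ∀ i j, herm p q (b i) (b j) = if i = j then (s i : ℂ) else 0

/-- A non-isotropic `z` splits off: `W = (W ∩ z^⊥) ⊕ ℂz`. -/
lemma finrank_inf_orthogonal {W : Submodule ℂ (E p q)} {z : E p q} (hz : z ∈ W)
    (h : herm p q z z ≠ 0) :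
    Module.finrank ℂ (W ⊓ LinearMap.ker ((hermForm p q).flip z) : Submodule ℂ (E p q)) + 1
      = Module.finrank ℂ W := by
  set W' := (W ⊓ LinearMap.ker ((hermForm p q).flip z) : Submodule ℂ (E p q)) with hW'
  have hmem : ∀ x, x ∈ W' ↔ x ∈ W ∧ herm p q x z = 0 := fun x => by simp [hW']
  have hz0 : z ≠ 0 := by rintro rfl; simp at h
  have hsup : W' ⊔ Submodule.span ℂ {z} = W := by
    refine le_antisymm (sup_le inf_le_left (by simpa using hz)) fun x hx => ?_
    rw [Submodule.mem_sup]
    refine ⟨x - (herm p q x z / herm p q z z) • z, (hmem _).2 ⟨W.sub_mem hx (W.smul_mem _ hz), ?_⟩,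
      (herm p q x z / herm p q z z) • z, Submodule.smul_mem _ _ (by simp), by simp⟩
    rw [herm_sub_left, herm_smul_left', div_mul_cancel₀ _ h, sub_self]
  have hinf : W' ⊓ Submodule.span ℂ {z} = ⊥ := by
    refine (Submodule.eq_bot_iff _).2 fun x hx => ?_
    obtain ⟨hx1, hx2⟩ := Submodule.mem_inf.1 hx
    obtain ⟨c, rfl⟩ := Submodule.mem_span_singleton.1 hx2
    have h1 := ((hmem _).1 hx1).2
    rw [herm_smul_left'] at h1
    rw [(mul_eq_zero.1 h1).resolve_right h, zero_smul]
  have := Submodule.finrank_sup_add_finrank_inf_eq W' (Submodule.span ℂ {z})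
  rw [hsup, hinf, finrank_bot, finrank_span_singleton hz0] at this
  omega

/-- Gram–Schmidt. By polarization a nondegenerate `W ≠ 0` contains a non-isotropic vector, and its
orthogonal complement in `W` is again nondegenerate. -/
lemma exists_signedOrthonormal (n : ℕ) (W : Submodule ℂ (E p q))
    (hn : Module.finrank ℂ W = n) (hW : PairsLeft W W) :
    ∃ (b : Fin n → E p q) (s : Fin n → ℝ), SignedOrthonormal b s ∧ ∀ i, b i ∈ W := by
  induction n generalizing W with
  | zero => exact ⟨Fin.elim0, Fin.elim0, ⟨fun i => i.elim0, fun i => i.elim0⟩, fun i => i.elim0⟩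
  | succ n ih =>
    obtain ⟨z, hz, hzz⟩ : ∃ z ∈ W, herm p q z z ≠ 0 := by
      by_contra! hcon
      have : W = ⊥ := by
        refine (Submodule.eq_bot_iff _).2 fun z hz => hW z hz fun w hw => ?_
        have h1 := herm_polarization z w
        rw [hcon _ (W.add_mem hz hw), hcon _ (W.sub_mem hz hw),
          hcon _ (W.add_mem hz (W.smul_mem _ hw)), hcon _ (W.sub_mem hz (W.smul_mem _ hw))] at h1
        simpa using h1
      rw [this, finrank_bot] at hn
      omega
    have hdim := finrank_inf_orthogonal hz hzz
    set W' := (W ⊓ LinearMap.ker ((hermForm p q).flip z) : Submodule ℂ (E p q)) with hW'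
    have hmem : ∀ x, x ∈ W' ↔ x ∈ W ∧ herm p q x z = 0 := fun x => by simp [hW']
    obtain ⟨b, s, hbs, hb⟩ := ih W' (by omega) fun x hx h => by
      refine hW x ((hmem x).1 hx).1 fun w hw => ?_
      -- The test vector is the projection of `w` to `z^⊥`; the removed part is orthogonal to `x`
      -- anyway.
      have h1 := h (w - (herm p q w z / herm p q z z) • z)
        ((hmem _).2 ⟨W.sub_mem hw (W.smul_mem _ hz), by
          rw [herm_sub_left, herm_smul_left', div_mul_cancel₀ _ hzz, sub_self]⟩)
      rwa [herm_sub_right, herm_smul_right', ((hmem x).1 hx).2, mul_zero, sub_zero] at h1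
    set r : ℝ := (herm p q z z).re with hr
    have hr0 : r ≠ 0 := fun h0 => hzz (by rw [herm_self, ← hr, h0]; simp)
    set c : ℝ := (Real.sqrt |r|)⁻¹ with hc
    have hcr : c * (c * r) = SignType.sign r := by
      have h1 : Real.sqrt |r| * Real.sqrt |r| = |r| := Real.mul_self_sqrt (abs_nonneg r)
      rw [← mul_assoc, hc, ← mul_inv, h1]
      rcases lt_or_gt_of_ne hr0 with h | h
      · rw [abs_of_neg h, sign_neg h]; simp; field_simp
      · rw [abs_of_pos h, sign_pos h]; simp; field_simp
    refine ⟨Fin.cons ((c : ℂ) • z) b, Fin.cons (SignType.sign r : ℝ) s, ⟨?_, ?_⟩, ?_⟩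
    · refine Fin.cases ?_ ?_
      · rcases lt_or_gt_of_ne hr0 with h | h
        · right; simp [sign_neg h]
        · left; simp [sign_pos h]
      · simpa using hbs.sign
    · refine Fin.cases (Fin.cases ?_ fun j => ?_) fun i => Fin.cases ?_ fun j => ?_
      · simp only [Fin.cons_zero, if_true, herm_smul_left', herm_smul_right']
        rw [herm_self, ← hr, ← hcr]
        simp
      · rw [if_neg (Fin.succ_ne_zero j).symm]
        simp only [Fin.cons_zero, Fin.cons_succ, herm_smul_left']
        rw [herm_eq_zero_comm.1 ((hmem _).1 (hb j)).2, mul_zero]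
      · rw [if_neg (Fin.succ_ne_zero i)]
        simp only [Fin.cons_zero, Fin.cons_succ, herm_smul_right']
        rw [((hmem _).1 (hb i)).2, mul_zero]
      · simp [hbs.herm]
    · exact Fin.cases (W.smul_mem _ hz) fun i => by simpa using ((hmem _).1 (hb i)).1

/-- Pairing a linear relation among the `a i` with `b j` isolates its `j`-th coefficient. -/
lemma linearIndependent_of_herm {ι : Type*} [DecidableEq ι] [Fintype ι] {a b : ι → E p q}
    {s : ι → ℂ} (hs : ∀ i, s i ≠ 0)
    (h : ∀ i j, herm p q (a i) (b j) = if i = j then s i else 0) : LinearIndependent ℂ a := by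
  refine Fintype.linearIndependent_iff.2 fun g hg j => ?_
  have h1 := congrArg (herm p q · (b j)) hg
  simp only [herm_sum_left, herm_smul_left', h, herm_zero_left, mul_ite, mul_zero,
    Finset.sum_ite_eq', Finset.mem_univ, if_true] at h1
  exact (mul_eq_zero.1 h1).resolve_right (hs j)

namespace SignedOrthonormal

variable {ι : Type*} [DecidableEq ι] {b : ι → E p q} {s : ι → ℝ}

lemma subtype (h : SignedOrthonormal b s) (P : ι → Prop) :
    SignedOrthonormal (fun i : {i // P i} => b i) (fun i => s i) :=
  ⟨fun i => h.sign i, fun i j => by simp [h.herm, Subtype.ext_iff]⟩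

variable [Fintype ι]

lemma linearIndependent (h : SignedOrthonormal b s) : LinearIndependent ℂ b :=
  linearIndependent_of_herm (s := fun i => (s i : ℂ))
    (fun i => by rcases h.sign i with h | h <;> simp [h]) h.herm

lemma herm_sum (h : SignedOrthonormal b s) (c : ι → ℂ) :
    (SUpq.herm p q (∑ i, c i • b i) (∑ i, c i • b i)).re = ∑ i, Complex.normSq (c i) * s i := by
  simp only [herm_sum_left, herm_sum_right, herm_smul_left', herm_smul_right', h.herm, mul_ite,
    mul_zero, Finset.sum_ite_eq', Finset.mem_univ, if_true, Complex.re_sum]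
  refine Finset.sum_congr rfl fun i _ => ?_
  rw [mul_left_comm, ← mul_assoc, RCLike.star_def, Complex.mul_conj, Complex.re_ofReal_mul, Complex.ofReal_re]

lemma span_eq (h : SignedOrthonormal b s) {W : Submodule ℂ (E p q)} (hb : ∀ i, b i ∈ W)
    (hW : Module.finrank ℂ W = Fintype.card ι) : Submodule.span ℂ (Set.range b) = W :=
  Submodule.eq_of_le_of_finrank_eq (Submodule.span_le.2 (by rintro _ ⟨i, rfl⟩; exact hb i))
    (by rw [finrank_span_eq_card h.linearIndependent, hW])

end SignedOrthonormal

/-- The maximal dimension of a subspace of `W` on which `ε h` is positive definite. -/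
noncomputable def index (ε : ℝ) (W : Submodule ℂ (E p q)) : ℕ :=
  sSup {n | ∃ V ≤ W, Module.finrank ℂ V = n ∧ ∀ z ∈ V, z ≠ 0 → 0 < ε * (herm p q z z).re}

lemma index_one (W : Submodule ℂ (E p q)) : index 1 W = posIndex W := by
  simp [index, posIndex]

lemma index_neg_one (W : Submodule ℂ (E p q)) : index (-1) W = negIndex W := by
  simp [index, negIndex]

/-- Law of inertia: the vectors of sign `ε` span a subspace on which `ε h` is positive. Any other
such subspace meets the span of the vectors of sign `-ε` only in 0, which bounds its dimension. -/
lemma SignedOrthonormal.index_eq {ι : Type*} [DecidableEq ι] [Fintype ι] {b : ι → E p q}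
    {s : ι → ℝ} (h : SignedOrthonormal b s) {ε : ℝ} (hε : ε = 1 ∨ ε = -1) :
    index ε (Submodule.span ℂ (Set.range b)) = Nat.card {i // s i = ε} := by
  classical
  have hεε : ε * ε = 1 := by rcases hε with rfl | rfl <;> norm_num
  have hε0 : ε ≠ -ε := by rcases hε with rfl | rfl <;> norm_num
  have hcard : Fintype.card {i // s i = ε} + Fintype.card {i // s i = -ε} = Fintype.card ι := by
    have h2 : ∀ i, s i = -ε ↔ ¬ s i = ε := fun i => by
      rcases hε with rfl | rfl <;> rcases h.sign i with h | h <;> rw [h] <;> norm_num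
    rw [Fintype.card_congr (Equiv.subtypeEquivRight h2)]
    have := Fintype.card_subtype_compl (fun i => s i = ε)
    have := Fintype.card_subtype_le (fun i => s i = ε)
    omega
  have hle : ∀ P : ι → Prop, Submodule.span ℂ (Set.range fun i : {i // P i} => b i)
      ≤ Submodule.span ℂ (Set.range b) := fun P =>
    Submodule.span_mono (by rintro _ ⟨i, rfl⟩; exact ⟨i, rfl⟩)
  rw [Nat.card_eq_fintype_card]
  refine IsGreatest.csSup_eq ⟨⟨_, hle (fun i => s i = ε),
    finrank_span_eq_card (h.subtype _).linearIndependent, fun z hz hz0 => ?_⟩, ?_⟩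
  · obtain ⟨c, rfl⟩ := (Submodule.mem_span_range_iff_exists_fun ℂ).1 hz
    rw [(h.subtype _).herm_sum, Finset.mul_sum]
    have h1 : ∀ i : {i // s i = ε}, ε * (Complex.normSq (c i) * s i) = Complex.normSq (c i) := by
      rintro ⟨i, hi⟩
      simp only [hi]
      linear_combination (Complex.normSq (c ⟨i, hi⟩)) * hεε
    simp only [h1]
    refine lt_of_le_of_ne (Finset.sum_nonneg fun i _ => Complex.normSq_nonneg _) fun h0 => hz0 ?_
    have := (Finset.sum_eq_zero_iff_of_nonneg fun i _ => Complex.normSq_nonneg (c i)).1 h0.symm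
    refine Finset.sum_eq_zero fun i hi => ?_
    rw [Complex.normSq_eq_zero.1 (this i hi), zero_smul]
  · rintro n ⟨V, hV, rfl, hpos⟩
    have hdisj : V ⊓ Submodule.span ℂ (Set.range fun i : {i // s i = -ε} => b i) = ⊥ := by
      refine (Submodule.eq_bot_iff _).2 fun z hz => ?_
      obtain ⟨hz1, hz2⟩ := Submodule.mem_inf.1 hz
      by_contra hz0
      have h1 := hpos z hz1 hz0
      obtain ⟨c, rfl⟩ := (Submodule.mem_span_range_iff_exists_fun ℂ).1 hz2
      rw [(h.subtype _).herm_sum, Finset.mul_sum] at h1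
      refine absurd h1 (not_lt.2 (Finset.sum_nonpos ?_))
      rintro ⟨i, hi⟩ -
      simp only [hi]
      have := Complex.normSq_nonneg (c ⟨i, hi⟩)
      nlinarith
    have h1 := Submodule.finrank_sup_add_finrank_inf_eq V
      (Submodule.span ℂ (Set.range fun i : {i // s i = -ε} => b i))
    rw [hdisj, finrank_bot, finrank_span_eq_card (h.subtype _).linearIndependent] at h1
    have h2 := Submodule.finrank_mono (sup_le hV (hle fun i => s i = -ε))
    rw [finrank_span_eq_card h.linearIndependent] at h2
    omega

lemma exists_map_of_linearIndependent {ι : Type*} {b : ι → E p q} (hb : LinearIndependent ℂ b)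
    (b' : ι → E p q) : ∃ ψ : E p q →ₗ[ℂ] E p q, ∀ i, ψ (b i) = b' i := by
  obtain ⟨ψ, hψ⟩ := LinearMap.exists_extend ((Module.Basis.span hb).constr ℂ b')
  refine ⟨ψ, fun i => ?_⟩
  have h1 := LinearMap.congr_fun hψ (Module.Basis.span hb i)
  rw [Module.Basis.constr_basis] at h1
  simpa [Module.Basis.span_apply] using h1

/-- Two maps `ψ`, `φ` are allowed because the two halves of a dual pair are moved independently. -/
lemma herm_map_span {A B : Set (E p q)} {ε : ℂ} {ψ φ : E p q →ₗ[ℂ] E p q}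
    (h : ∀ a ∈ A, ∀ b ∈ B, herm p q (ψ a) (φ b) = ε * herm p q a b) {z w : E p q}
    (hz : z ∈ Submodule.span ℂ A) (hw : w ∈ Submodule.span ℂ B) :
    herm p q (ψ z) (φ w) = ε * herm p q z w := by
  induction hz using Submodule.span_induction with
  | zero => simp
  | add x y _ _ hx hy => rw [map_add, herm_add_left, herm_add_left, hx, hy, mul_add]
  | smul c x _ hx => rw [map_smul, herm_smul_left', herm_smul_left', hx]; ring
  | mem x hx =>
    induction hw using Submodule.span_induction with
    | zero => simp
    | add x y _ _ hx hy => rw [map_add, herm_add_right, herm_add_right, hx, hy, mul_add]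
    | smul c x _ hx => rw [map_smul, herm_smul_right', herm_smul_right', hx]; ring
    | mem w hw => exact h x hx w hw

lemma exists_equiv_of_card_fiber_eq {ι κ T : Type*} [Finite ι] [Finite κ] {f : ι → T} {g : κ → T}
    (h : ∀ t, Nat.card {i // f i = t} = Nat.card {i // g i = t}) :
    ∃ e : ι ≃ κ, ∀ i, g (e i) = f i :=
  ⟨Equiv.ofFiberEquiv fun t => (Finite.card_eq.1 (h t)).some, Equiv.ofFiberEquiv_map _⟩

/-- Nondegenerate subspaces of the same type are isometric. -/
lemma exists_isometry {ε : ℝ} (hε : ε = 1 ∨ ε = -1) {W W' : Submodule ℂ (E p q)}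
    (hW : PairsLeft W W) (hW' : PairsLeft W' W')
    (h : ∀ δ : ℝ, δ = 1 ∨ δ = -1 → index δ W = index (ε * δ) W') :
    ∃ ψ : E p q →ₗ[ℂ] E p q, W.map ψ = W' ∧
      ∀ z ∈ W, ∀ w ∈ W, herm p q (ψ z) (ψ w) = ε * herm p q z w := by
  have hεε : ε * ε = 1 := by rcases hε with rfl | rfl <;> norm_num
  obtain ⟨b, s, hbs, hb⟩ := exists_signedOrthonormal _ W rfl hW
  obtain ⟨b', s', hbs', hb'⟩ := exists_signedOrthonormal _ W' rfl hW'
  have hsp := hbs.span_eq hb (by simp)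
  have hsp' := hbs'.span_eq hb' (by simp)
  obtain ⟨e, he⟩ := exists_equiv_of_card_fiber_eq (f := s) (g := fun i => ε * s' i) fun t => by
    by_cases ht : t = 1 ∨ t = -1
    · have hεt : ε * t = 1 ∨ ε * t = -1 := by
        rcases hε with rfl | rfl <;> rcases ht with rfl | rfl <;> norm_num
      rw [← hbs.index_eq ht, hsp, h t ht]
      refine (congrArg _ hsp'.symm).trans ((hbs'.index_eq hεt).trans ?_)
      refine Nat.card_congr (Equiv.subtypeEquivRight fun i => ⟨fun hi => ?_, fun hi => ?_⟩)
      · rw [hi, ← mul_assoc, hεε, one_mul]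
      · rw [← hi, ← mul_assoc, hεε, one_mul]
    -- Values other than `±1` are not signs, so both fibres are empty.
    · have h1 : IsEmpty {i // s i = t} := ⟨fun i => ht (i.2 ▸ hbs.sign i)⟩
      have h2 : IsEmpty {i // ε * s' i = t} := ⟨fun i => ht (by
        rw [← i.2]
        rcases hε with rfl | rfl <;> rcases hbs'.sign i with h | h <;> rw [h] <;> norm_num)⟩
      simp
  obtain ⟨ψ, hψ⟩ := exists_map_of_linearIndependent hbs.linearIndependent (b' ∘ e)
  refine ⟨ψ, ?_, fun z hz w hw => ?_⟩
  · calc W.map ψ = (Submodule.span ℂ (Set.range b)).map ψ := by rw [hsp]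
      _ = Submodule.span ℂ (Set.range (b' ∘ e)) := by
        rw [Submodule.map_span, ← Set.range_comp]
        exact congrArg _ (congrArg _ (funext hψ))
      _ = W' := by rw [e.surjective.range_comp b', hsp']
  · replace hz := hsp.ge hz
    replace hw := hsp.ge hw
    refine herm_map_span ?_ hz hw
    rintro _ ⟨i, rfl⟩ _ ⟨j, rfl⟩
    rw [hψ, hψ, Function.comp_apply, Function.comp_apply, hbs.herm, hbs'.herm]
    simp only [EmbeddingLike.apply_eq_iff_eq]
    split_ifs
    · rw [← he i]
      push_cast
      rw [← mul_assoc, ← Complex.ofReal_mul, hεε, Complex.ofReal_one, one_mul]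
    · simp

/-- Pairing with a basis of `B` gives coordinates on `A`; they are injective because the pairing has
no left kernel. -/
lemma exists_injective_of_pairsLeft {A B : Submodule ℂ (E p q)} (h : PairsLeft A B)
    {ι : Type*} [Fintype ι] (c : Module.Basis ι ℂ B) :
    ∃ f : A →ₗ[ℂ] (ι → ℂ), Function.Injective f ∧ ∀ z j, f z j = herm p q z (c j) := by
  refine ⟨LinearMap.pi fun j => ((hermForm p q).flip (c j : E p q)).comp A.subtype, ?_,
    fun z j => by simp⟩
  rw [← LinearMap.ker_eq_bot, LinearMap.ker_eq_bot']
  intro z hz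
  refine Subtype.ext (h z z.2 fun w hw => ?_)
  have h1 : ∑ j, c.repr ⟨w, hw⟩ j • (c j : E p q) = w := by
    have := congrArg B.subtype (c.sum_repr ⟨w, hw⟩)
    rwa [map_sum] at this
  rw [← h1, herm_sum_right]
  refine Finset.sum_eq_zero fun j _ => ?_
  rw [herm_smul_right']
  have h2 : herm p q z (c j) = 0 := by simpa using congrFun hz j
  rw [h2, mul_zero]

lemma finrank_le_of_pairsLeft {A B : Submodule ℂ (E p q)} (h : PairsLeft A B) :
    Module.finrank ℂ A ≤ Module.finrank ℂ B := by
  obtain ⟨f, hf, -⟩ := exists_injective_of_pairsLeft h (Module.finBasis ℂ B)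
  simpa using LinearMap.finrank_le_finrank_of_injective hf

lemma finrank_eq_of_pairsLeft {A B : Submodule ℂ (E p q)} (h : PairsLeft A B)
    (h' : PairsLeft B A) : Module.finrank ℂ A = Module.finrank ℂ B :=
  le_antisymm (finrank_le_of_pairsLeft h) (finrank_le_of_pairsLeft h')

lemma span_range_basis {ι : Type*} {C : Submodule ℂ (E p q)} (c : Module.Basis ι ℂ C) :
    Submodule.span ℂ (Set.range fun i => (c i : E p q)) = C := by
  have := congrArg (Submodule.map C.subtype) c.span_eq
  rwa [Submodule.map_span, ← Set.range_comp, Submodule.map_top, Submodule.range_subtype] at this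

lemma exists_dual_families {A B : Submodule ℂ (E p q)} (h : PairsLeft A B)
    (h' : PairsLeft B A) {n : ℕ} (hn : Module.finrank ℂ A = n) :
    ∃ a b : Fin n → E p q, (∀ i j, herm p q (a i) (b j) = if i = j then 1 else 0) ∧
      Submodule.span ℂ (Set.range a) = A ∧ Submodule.span ℂ (Set.range b) = B := by
  let c := Module.finBasisOfFinrankEq ℂ B ((finrank_eq_of_pairsLeft h h').symm.trans hn)
  obtain ⟨f, hf, hfz⟩ := exists_injective_of_pairsLeft h c
  let e := LinearEquiv.ofInjectiveOfFinrankEq f hf (by rw [Module.finrank_fin_fun, hn])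
  have he : ∀ z, e z = f z := fun z => rfl
  -- In the coordinates given by pairing with `c`, the standard basis is the basis of `A` dual to
  -- `c`.
  refine ⟨fun i => Module.Basis.ofEquivFun e i, fun i => c i, fun i j => ?_,
    span_range_basis _, span_range_basis _⟩
  rw [← hfz, ← he, Module.Basis.coe_ofEquivFun, LinearEquiv.apply_symm_apply, Pi.single_apply]
  simp only [eq_comm]

/-- Dual pairs of subspaces of the same dimension are isometric. -/
lemma exists_isometry_of_pairs {ε : ℂ} (hε : ε ≠ 0) {A B A' B' : Submodule ℂ (E p q)}
    (h : PairsLeft A B) (h' : PairsLeft B A)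
    (hh : PairsLeft A' B') (hh' : PairsLeft B' A')
    (hn : Module.finrank ℂ A = Module.finrank ℂ A') :
    ∃ ψ φ : E p q →ₗ[ℂ] E p q, A.map ψ = A' ∧ B.map φ = B' ∧
      ∀ z ∈ A, ∀ w ∈ B, herm p q (ψ z) (φ w) = ε * herm p q z w := by
  obtain ⟨a, b, hab, ha, hb⟩ := exists_dual_families h h' hn
  obtain ⟨a', b', hab', ha', hb'⟩ := exists_dual_families hh hh' rfl
  have la : LinearIndependent ℂ a := linearIndependent_of_herm (fun _ => one_ne_zero) hab
  have lb : LinearIndependent ℂ b :=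
    linearIndependent_of_herm (a := b) (b := a) (s := fun _ => 1) (fun _ => one_ne_zero)
      fun i j => by rw [← herm_star, hab]; simp [eq_comm, apply_ite]
  obtain ⟨ψ, hψ⟩ := exists_map_of_linearIndependent la a'
  obtain ⟨φ, hφ⟩ := exists_map_of_linearIndependent lb b'
  -- One half alone absorbs the factor `ε`; rescaling does not change the image.
  refine ⟨ε • ψ, φ, ?_, ?_, fun z hz w hw => ?_⟩
  · rw [Submodule.map_smul _ _ _ hε, ← ha, Submodule.map_span, ← Set.range_comp]
    exact (congrArg _ (congrArg _ (funext hψ))).trans ha'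
  · rw [← hb, Submodule.map_span, ← Set.range_comp]
    exact (congrArg _ (congrArg _ (funext hφ))).trans hb'
  · rw [← ha] at hz
    rw [← hb] at hw
    refine herm_map_span ?_ hz hw
    rintro _ ⟨i, rfl⟩ _ ⟨j, rfl⟩
    rw [LinearMap.smul_apply, herm_smul_left', hψ, hφ, hab, hab']

/-- A family of linear maps on the summands of a direct sum glues to a linear map. -/
lemma exists_linearMap_of_iSupIndep {K V V' ι : Type*} [Field K] [AddCommGroup V] [Module K V]
    [AddCommGroup V'] [Module K V'] {U : ι → Submodule K V} (h : iSupIndep U) (ht : iSup U = ⊤)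
    (ψ : ι → V →ₗ[K] V') : ∃ f : V →ₗ[K] V', ∀ i, ∀ z ∈ U i, f z = ψ i z := by
  classical
  have hI := DirectSum.isInternal_submodule_of_iSupIndep_of_iSup_eq_top h ht
  let e := LinearEquiv.ofBijective (DirectSum.coeLinearMap U) hI
  refine ⟨(DirectSum.toModule K ι V' fun i => (ψ i).comp (U i).subtype).comp e.symm.toLinearMap,
    fun i z hz => ?_⟩
  have h1 : e.symm z = DirectSum.lof K ι (fun i => U i) i ⟨z, hz⟩ := by
    rw [LinearEquiv.symm_apply_eq]
    exact (DirectSum.coeLinearMap_lof U i ⟨z, hz⟩).symm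
  simp [h1]

end SUpq

/-! ### Toral part, joint eigenspaces and centralizer -/

namespace SUpq

variable {p q : ℕ} {v : LieSubalgebra ℝ (Mat p q)}

lemma commute_of_isLieAbelian (hv : IsLieAbelian v) {X Y : Mat p q} (hX : X ∈ v) (hY : Y ∈ v) :
    Commute X Y := by
  have h0 : ⁅(⟨X, hX⟩ : v), (⟨Y, hY⟩ : v)⁆ = 0 := hv.trivial _ _
  have h1 : ⁅X, Y⁆ = 0 := congrArg Subtype.val h0
  rwa [Ring.lie_def, sub_eq_zero] at h1

lemma commute_toLin' {X Y : Mat p q} (h : Commute X Y) :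
    Commute (Matrix.toLin' X) (Matrix.toLin' Y) := by
  simp only [Commute, SemiconjBy, Module.End.mul_eq_comp, ← Matrix.toLin'_mul, h.eq]

lemma iSupIndep_jointEigenspace (hv : IsLieAbelian v) :
    iSupIndep (jointEigenspace (toralPart v)) :=
  (Module.End.independent_iInf_maxGenEigenspace_of_forall_mapsTo
    (fun X : toralPart v => Matrix.toLin' X.1)
    (fun X Y _ => Module.End.mapsTo_maxGenEigenspace_of_comm
      (commute_toLin' (commute_of_isLieAbelian hv Y.2.1 X.2.1)) _)).mono
    fun _ => iInf_mono fun _ => Module.End.eigenspace_le_maxGenEigenspace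

/-- Over `ℂ` a commuting family has joint generalized eigenspaces that span; semisimplicity makes
them honest eigenspaces. -/
lemma iSup_jointEigenspace (hv : IsLieAbelian v) :
    ⨆ χ, jointEigenspace (toralPart v) χ = ⊤ := by
  have := Module.End.iSup_iInf_maxGenEigenspace_eq_top_of_iSup_maxGenEigenspace_eq_top_of_commute
    (fun X : toralPart v => Matrix.toLin' X.1)
    (fun X Y _ => commute_toLin' (commute_of_isLieAbelian hv X.2.1 Y.2.1))
    (fun X => Module.End.iSup_maxGenEigenspace_eq_top _)
  rw [← this]
  refine iSup_congr fun _ => iInf_congr fun X => ?_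
  exact (X.2.2.isFinitelySemisimple.maxGenEigenspace_eq_eigenspace _).symm

/-- Two endomorphisms that agree on all joint eigenspaces are equal. -/
lemma eq_of_forall_weights (hv : IsLieAbelian v) {X Y : Mat p q}
    (h : ∀ χ ∈ weights v, ∀ z ∈ jointEigenspace (toralPart v) χ, X *ᵥ z = Y *ᵥ z) : X = Y := by
  refine Matrix.mulVec_injective (funext fun z => ?_)
  have hz : z ∈ ⨆ χ, jointEigenspace (toralPart v) χ := by
    rw [iSup_jointEigenspace hv]; exact Submodule.mem_top
  induction hz using Submodule.iSup_induction' with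
  | zero => simp
  | add x y _ _ hx hy => rw [Matrix.mulVec_add, Matrix.mulVec_add, hx, hy]
  | mem χ x hx =>
    by_cases hχ : χ ∈ weights v
    · exact h χ hχ x hx
    · have h0 : jointEigenspace (toralPart v) χ = ⊥ := not_not.1 hχ
      rw [h0, Submodule.mem_bot] at hx
      simp [hx]

lemma mulVec_mem_jointEigenspace {A : Set (Mat p q)} {Y : Mat p q} (h : ∀ X ∈ A, Commute Y X)
    {χ : A → ℂ} {z : E p q} (hz : z ∈ jointEigenspace A χ) : Y *ᵥ z ∈ jointEigenspace A χ := by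
  rw [mem_jointEigenspace] at hz ⊢
  intro X
  rw [Matrix.mulVec_mulVec, ← (h X X.2).eq, ← Matrix.mulVec_mulVec, hz, Matrix.mulVec_smul]

lemma IsMASA.le_su (hv : IsMASA v) : v ≤ su p q := hv.1.1

lemma IsMASA.isLieAbelian (hv : IsMASA v) : IsLieAbelian v := hv.1.2

/-- Otherwise `v + ℝX` would be a larger abelian subalgebra of `𝔤`. -/
lemma IsMASA.mem_of_commute (hv : IsMASA v) {X : Mat p q} (hX : X ∈ su p q)
    (h : ∀ Y ∈ v, Commute X Y) : X ∈ v := by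
  have hc : ∀ Y ∈ v.toSubmodule ⊔ Submodule.span ℝ {X}, ∀ Z ∈ v.toSubmodule ⊔ Submodule.span ℝ {X},
      Commute Y Z := by
    intro Y hY Z hZ
    obtain ⟨Y', hY', a, ha, rfl⟩ := Submodule.mem_sup.1 hY
    obtain ⟨Z', hZ', b, hb, rfl⟩ := Submodule.mem_sup.1 hZ
    obtain ⟨a, rfl⟩ := Submodule.mem_span_singleton.1 ha
    obtain ⟨b, rfl⟩ := Submodule.mem_span_singleton.1 hb
    have h1 := commute_of_isLieAbelian hv.isLieAbelian hY' hZ'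
    have h2 := h Z' hZ'
    have h3 := h Y' hY'
    exact (h1.add_right (h3.symm.smul_right b)).add_left
      ((h2.smul_left a).add_right (((Commute.refl X).smul_left a).smul_right b))
  let w : LieSubalgebra ℝ (Mat p q) :=
    { v.toSubmodule ⊔ Submodule.span ℝ {X} with
      lie_mem' := fun {Y Z} hY hZ => by
        rw [(hc Y hY Z hZ).lie_eq]
        exact Submodule.zero_mem _ }
  have hw : w ≤ su p q ∧ IsLieAbelian w := by
    refine ⟨?_, ⟨fun Y Z => Subtype.ext (hc Y Y.2 Z Z.2).lie_eq⟩⟩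
    change v.toSubmodule ⊔ Submodule.span ℝ {X} ≤ (su p q).toSubmodule
    exact sup_le hv.le_su (by simpa using hX)
  have hvw : v ≤ w := fun Y hY => Submodule.mem_sup_left hY
  exact hv.2 hw hvw (Submodule.mem_sup_right (Submodule.mem_span_singleton_self X) :
    X ∈ v.toSubmodule ⊔ Submodule.span ℝ {X})

@[simp] lemma bar_bar (χ : toralPart v → ℂ) : bar (bar χ) = χ := by funext X; simp [bar]

/-- A vector of `E_χ` is orthogonal to every `E_ψ` with `ψ ≠ χ̄`, so one that is also orthogonal to
`E_χ̄` lies in the kernel of the nondegenerate form. -/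
lemma pairsLeft_jointEigenspace (hv : IsMASA v) (χ : toralPart v → ℂ) :
    PairsLeft (jointEigenspace (toralPart v) χ) (jointEigenspace (toralPart v) (bar χ)) := by
  intro z hz h
  refine eq_zero_of_herm_eq_zero fun w => ?_
  have hw : w ∈ ⨆ χ, jointEigenspace (toralPart v) χ := by
    rw [iSup_jointEigenspace hv.isLieAbelian]; exact Submodule.mem_top
  induction hw using Submodule.iSup_induction' with
  | zero => simp
  | add x y _ _ hx hy => rw [herm_add_right, hx, hy, add_zero]
  | mem ψ x hx =>
    by_cases hψ : ψ = bar χ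
    · subst hψ; exact h x hx
    · exact herm_eq_zero_of_ne_bar hv.le_su hψ hz hx

lemma pairsLeft_jointEigenspace_bar (hv : IsMASA v) (χ : toralPart v → ℂ) :
    PairsLeft (jointEigenspace (toralPart v) (bar χ)) (jointEigenspace (toralPart v) χ) := by
  simpa using pairsLeft_jointEigenspace hv (bar χ)

lemma finrank_jointEigenspace_bar (hv : IsMASA v) (χ : toralPart v → ℂ) :
    Module.finrank ℂ (jointEigenspace (toralPart v) (bar χ))
      = Module.finrank ℂ (jointEigenspace (toralPart v) χ) :=
  finrank_eq_of_pairsLeft (pairsLeft_jointEigenspace_bar hv χ) (pairsLeft_jointEigenspace hv χ)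

lemma mem_weights_iff_finrank {χ : toralPart v → ℂ} :
    χ ∈ weights v ↔ Module.finrank ℂ (jointEigenspace (toralPart v) χ) ≠ 0 := by
  rw [Ne, Submodule.finrank_eq_zero]; rfl

lemma bar_mem_weights (hv : IsMASA v) {χ : toralPart v → ℂ} : bar χ ∈ weights v ↔ χ ∈ weights v := by
  rw [mem_weights_iff_finrank, mem_weights_iff_finrank, finrank_jointEigenspace_bar hv]

/-- The toral part consists of the elements of `𝔤` that are scalar on every joint eigenspace. -/
lemma mem_toralPart_iff (hv : IsMASA v) {X : Mat p q} :
    X ∈ toralPart v ↔ X ∈ su p q ∧ ∀ χ ∈ weights v, ∃ c : ℂ,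
      ∀ z ∈ jointEigenspace (toralPart v) χ, X *ᵥ z = c • z := by
  refine ⟨fun h => ⟨hv.le_su h.1, fun χ _ => ⟨χ ⟨X, h⟩, fun z hz =>
    mem_jointEigenspace.1 hz ⟨X, h⟩⟩⟩, fun ⟨hX, h⟩ => ?_⟩
  choose! c hc using h
  refine ⟨hv.mem_of_commute hX fun Y hY => ?_, ?_⟩
  · refine eq_of_forall_weights hv.isLieAbelian fun χ hχ z hz => ?_
    have hYz := mulVec_mem_jointEigenspace
      (fun Z hZ => commute_of_isLieAbelian hv.isLieAbelian hY hZ.1) hz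
    rw [← Matrix.mulVec_mulVec, ← Matrix.mulVec_mulVec, hc χ hχ z hz, hc χ hχ _ hYz,
      Matrix.mulVec_smul]
  · classical
    -- Taking the image as a finite set removes repeated scalars, so the annihilating product is
    -- squarefree.
    set S := ((weights_finite hv.isLieAbelian).toFinset).image c
    refine Module.End.isSemisimple_of_squarefree_aeval_eq_zero
      (p := ∏ a ∈ S, (Polynomial.X - Polynomial.C a))
      (Polynomial.separable_prod_X_sub_C_iff'.2 fun _ _ _ _ h => h).squarefree ?_
    have key : ∀ χ ∈ weights v, ∀ z ∈ jointEigenspace (toralPart v) χ,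
        Polynomial.aeval (Matrix.toLin' X) (∏ a ∈ S, (Polynomial.X - Polynomial.C a)) z = 0 := by
      intro χ hχ z hz
      have hS : c χ ∈ S := Finset.mem_image_of_mem _ (by simpa using hχ)
      rw [← Finset.prod_erase_mul _ _ hS, map_mul, Module.End.mul_apply]
      have : Polynomial.aeval (Matrix.toLin' X) (Polynomial.X - Polynomial.C (c χ)) z = 0 := by
        simp [hc χ hχ z hz]
      rw [this, map_zero]
    refine (LinearEquiv.map_eq_zero_iff LinearMap.toMatrix').1 ?_
    refine eq_of_forall_weights hv.isLieAbelian fun χ hχ z hz => ?_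
    rw [← Matrix.toLin'_apply, Matrix.toLin'_toMatrix', key χ hχ z hz, Matrix.zero_mulVec]

/-- An element of the centralizer of `C_𝔤(𝔳^red)` commutes with everything that commutes with
the toral part. -/
lemma commute_of_commute_suCentralizer (hm : (p : ℂ) + q ≠ 0) {A : Set (Mat p q)}
    (hA : ∀ Y ∈ A, Y ∈ su p q) {X : Mat p q}
    (hX : ∀ Y ∈ suCentralizer A, Commute X Y) {B : Mat p q} (hB : ∀ Y ∈ A, Commute B Y) :
    Commute X B := by
  -- Subtracting the mean of the diagonal makes `B` traceless without changing what it commutes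
  -- with.
  set B' : Mat p q := B - (B.trace / ((p : ℂ) + q)) • (1 : Mat p q) with hB'
  have htr : B'.trace = 0 := by
    simp [hB', Matrix.trace_sub, Matrix.trace_smul, Matrix.trace_one, hm]
  have hB'c : ∀ Y ∈ A, Commute B' Y := fun Y hY =>
    (hB Y hY).sub_left ((Commute.one_left Y).smul_left _)
  have hadj : ∀ Y ∈ A, Commute (hermAdj B') Y := fun Y hY => commute_hermAdj (hA Y hY) (hB'c Y hY)
  have h1 : Commute X (B' - hermAdj B') := hX _ ⟨sub_hermAdj_mem_su htr, fun Y hY =>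
    ((hB'c Y hY).sub_left (hadj Y hY)).lie_eq⟩
  have h2 : Commute X (Complex.I • (B' + hermAdj B')) := hX _ ⟨I_smul_add_hermAdj_mem_su htr,
    fun Y hY => (((hB'c Y hY).add_left (hadj Y hY)).smul_left _).lie_eq⟩
  have h3 : B = (1 / 2 : ℂ) • ((B' - hermAdj B') + (-Complex.I) • Complex.I • (B' + hermAdj B'))
      + (B.trace / ((p : ℂ) + q)) • (1 : Mat p q) := by
    rw [smul_smul, neg_mul, Complex.I_mul_I, neg_neg, one_smul, sub_add_add_cancel, ← two_smul ℂ B',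
      smul_smul, hB']
    norm_num
  rw [h3]
  exact ((h1.add_right (h2.smul_right _)).smul_right _).add_right
    ((Commute.one_right X).smul_right _)

/-- The toral part is the centre of its centralizer. -/
lemma mem_toralPart_iff_center (hm : (p : ℂ) + q ≠ 0) (hv : IsMASA v) {X : Mat p q} :
    X ∈ toralPart v ↔ X ∈ suCentralizer (toralPart v) ∧
      ∀ Y ∈ suCentralizer (toralPart v), ⁅X, Y⁆ = 0 := by
  refine ⟨fun h => ⟨⟨hv.le_su h.1, fun Y hY =>
    (commute_of_isLieAbelian hv.isLieAbelian h.1 hY.1).lie_eq⟩, fun Y hY => ?_⟩, fun ⟨h1, h2⟩ => ?_⟩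
  · rw [← lie_skew, hY.2 X h, neg_zero]
  · refine (mem_toralPart_iff hv).2 ⟨h1.1, fun χ hχ => ?_⟩
    obtain ⟨z₀, hz₀, hne⟩ := Submodule.exists_mem_ne_zero_of_ne_bot hχ
    obtain ⟨u, hu, hzu⟩ : ∃ u ∈ jointEigenspace (toralPart v) (bar χ), herm p q z₀ u ≠ 0 := by
      by_contra! hcon
      exact hne (pairsLeft_jointEigenspace hv χ z₀ hz₀ hcon)
    have hX : ∀ Y ∈ suCentralizer (toralPart v), Commute X Y := fun Y hY =>
      sub_eq_zero.1 (h2 Y hY)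
    refine ⟨herm p q (X *ᵥ z₀) u / herm p q z₀ u, fun z hz => ?_⟩
    -- The rank-one map `w ↦ h(w, u) z` with `z ∈ E_χ`, `u ∈ E_χ̄` commutes with the toral part,
    -- hence with `X`. Evaluating at `z₀` gives `h(z₀, u) X z = h(X z₀, u) z`, with a scalar
    -- independent of `z`.
    let B : Mat p q := LinearMap.toMatrix' (((hermForm p q).flip u).smulRight z)
    have hB : ∀ w, B *ᵥ w = herm p q w u • z := fun w => by
      rw [← Matrix.toLin'_apply, Matrix.toLin'_toMatrix']; rfl
    have hBc : ∀ Y ∈ toralPart v, Commute B Y := fun Y hY => by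
      refine Matrix.mulVec_injective (funext fun w => ?_)
      rw [← Matrix.mulVec_mulVec, ← Matrix.mulVec_mulVec, hB, hB, Matrix.mulVec_smul,
        mem_jointEigenspace.1 hz ⟨Y, hY⟩, smul_smul]
      have h3 := (hv.le_su hY.1).2 w u
      rw [mem_jointEigenspace.1 hu ⟨Y, hY⟩, herm_smul_right'] at h3
      congr 1
      simp only [bar, star_neg, star_star] at h3
      linear_combination h3
    have h4 := congrArg (· *ᵥ z₀)
      (commute_of_commute_suCentralizer hm (fun Y hY => hv.le_su hY.1) hX hBc).eq
    simp only [← Matrix.mulVec_mulVec, hB, Matrix.mulVec_smul] at h4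
    rw [div_eq_inv_mul, mul_smul, ← h4, smul_smul, inv_mul_cancel₀ hzu, one_smul]

end SUpq

/-! ### The `D`-invariant as a count of types, and its behaviour under conjugation -/

namespace SUpq

variable {p q : ℕ} {v : LieSubalgebra ℝ (Mat p q)}

/-- Representatives of the orbits of the involution on the set of joint eigenspaces. -/
def weightsReps (v : LieSubalgebra ℝ (Mat p q)) : Set (toralPart v → ℂ) :=
  weightsK v ∪ weightsL v

open Classical in
/-- The summand of the `D`-invariant that belongs to the joint eigenspace of `χ`. -/
noncomputable def weightType (χ : toralPart v → ℂ) : (ℕ × ℕ) ⊕ ℕ :=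
  if bar χ = χ then Sum.inl (posIndex (jointEigenspace (toralPart v) χ),
    negIndex (jointEigenspace (toralPart v) χ))
  else Sum.inr (Module.finrank ℂ (jointEigenspace (toralPart v) χ))

lemma bar_ne_of_mem_weightsL {χ : toralPart v → ℂ} (h : χ ∈ weightsL v) : bar χ ≠ χ := fun h0 =>
  irrefl_of WellOrderingRel χ (by simpa [h0] using h.2)

lemma weightsReps_subset : weightsReps v ⊆ weights v := by
  rintro χ (h | h) <;> exact h.1

lemma bar_eq_of_mem_weightsReps {χ : toralPart v → ℂ} (h : χ ∈ weightsReps v)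
    (h' : bar χ ∈ weightsReps v) : bar χ = χ := by
  rcases h with h | h
  · exact h.2
  · rcases h' with h' | h'
    · simpa using h'.2.symm
    · have h1 := h'.2
      rw [bar_bar] at h1
      exact absurd h1 (asymm_of WellOrderingRel h.2)

lemma mem_weightsReps_or (hv : IsMASA v) {χ : toralPart v → ℂ} (h : χ ∈ weights v) :
    χ ∈ weightsReps v ∨ bar χ ∈ weightsReps v := by
  rcases weights_cases h ((bar_mem_weights hv).2 h) with h | h | h
  · exact Or.inl (Or.inl h)
  · exact Or.inl (Or.inr h)
  · exact Or.inr (Or.inr h)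

lemma finite_weightsReps (hv : IsMASA v) : Finite (weightsReps v) :=
  ((weights_finite hv.isLieAbelian).subset weightsReps_subset).to_subtype

/-- The coefficients of the `D`-invariant count the joint eigenspaces of each type. -/
lemma DInvariant_apply (hv : IsMASA v) (x : (ℕ × ℕ) ⊕ ℕ) :
    DInvariant v x = Nat.card {χ : weightsReps v // weightType χ.1 = x} := by
  classical
  have hfin := (weights_finite hv.isLieAbelian)
  have hK : (weightsK v).Finite := hfin.subset fun χ h => h.1
  have hL : (weightsL v).Finite := hfin.subset fun χ h => h.1
  have hdisj : Disjoint (weightsK v) (weightsL v) :=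
    Set.disjoint_left.2 fun χ h h' => bar_ne_of_mem_weightsL h' h.2
  have h1 : DInvariant v = ∑ᶠ χ ∈ weightsReps v, Finsupp.single (weightType χ) 1 := by
    rw [weightsReps, finsum_mem_union hdisj hK hL, DInvariant]
    congr 1
    · exact finsum_mem_congr rfl fun χ h => by rw [weightType, if_pos h.2]
    · exact finsum_mem_congr rfl fun χ h => by
        rw [weightType, if_neg (bar_ne_of_mem_weightsL h)]
  have hS : (weightsReps v).Finite := hK.union hL
  rw [h1, finsum_mem_eq_finite_toFinset_sum _ hS, Finsupp.finsetSum_apply]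
  simp only [Finsupp.single_apply]
  rw [Finset.sum_boole, Nat.cast_id,
    Nat.card_congr (Equiv.subtypeSubtypeEquivSubtypeInter (· ∈ weightsReps v)
      (fun χ => weightType χ = x))]
  exact (Nat.subtype_card _ fun χ => by simp).symm

/-- The action of the sign of an isometry on types. -/
noncomputable def twist (ε : ℝ) (x : (ℕ × ℕ) ⊕ ℕ) : (ℕ × ℕ) ⊕ ℕ :=
  open Classical in if ε = 1 then x else Sum.map Prod.swap id x

lemma twist_twist (ε : ℝ) (x : (ℕ × ℕ) ⊕ ℕ) : twist ε (twist ε x) = x := by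
  unfold twist
  split_ifs
  · rfl
  · rcases x with ⟨a, b⟩ | n <;> rfl

lemma opp_apply (D : DMonoid) (x : (ℕ × ℕ) ⊕ ℕ) : D.opp x = D (twist (-1) x) := by
  rw [twist, if_neg (by norm_num)]
  exact Finsupp.mapDomain_equiv_apply
    (f := Equiv.sumCongr (Equiv.prodComm ℕ ℕ) (Equiv.refl ℕ)) D x

/-- `g` multiplies the hermitian form by `ε`. -/
def IsSimilitude (ε : ℝ) (g : SL p q) : Prop :=
  ∀ z w : E p q, herm p q ((g : Mat p q) *ᵥ z) ((g : Mat p q) *ᵥ w) = ε * herm p q z w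

lemma coe_mulVec_inv_mulVec (g : SL p q) (z : E p q) :
    (g : Mat p q) *ᵥ (((g⁻¹ : SL p q) : Mat p q) *ᵥ z) = z := by
  rw [Matrix.mulVec_mulVec, ← Matrix.SpecialLinearGroup.coe_mul, mul_inv_cancel,
    Matrix.SpecialLinearGroup.coe_one, Matrix.one_mulVec]

lemma inv_mulVec_coe_mulVec (g : SL p q) (z : E p q) :
    ((g⁻¹ : SL p q) : Mat p q) *ᵥ ((g : Mat p q) *ᵥ z) = z := by
  simpa using coe_mulVec_inv_mulVec g⁻¹ z

lemma IsSimilitude.inv {ε : ℝ} (hε : ε = 1 ∨ ε = -1) {g : SL p q} (hg : IsSimilitude ε g) :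
    IsSimilitude ε g⁻¹ := fun z w => by
  have h := hg (((g⁻¹ : SL p q) : Mat p q) *ᵥ z) (((g⁻¹ : SL p q) : Mat p q) *ᵥ w)
  rw [coe_mulVec_inv_mulVec, coe_mulVec_inv_mulVec] at h
  rw [h, ← mul_assoc, ← Complex.ofReal_mul]
  rcases hε with rfl | rfl <;> simp

lemma Ad_mulVec (g : SL p q) (X : Mat p q) (z : E p q) :
    Ad g X *ᵥ ((g : Mat p q) *ᵥ z) = (g : Mat p q) *ᵥ (X *ᵥ z) := by
  rw [Ad, ← Matrix.mulVec_mulVec, inv_mulVec_coe_mulVec, Matrix.mulVec_mulVec]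

lemma Ad_inv_Ad (g : SL p q) (X : Mat p q) : Ad g⁻¹ (Ad g X) = X := by
  refine Matrix.mulVec_injective (funext fun z => ?_)
  conv_lhs => rw [← inv_mulVec_coe_mulVec g z]
  rw [Ad_mulVec, Ad_mulVec, inv_mulVec_coe_mulVec]

lemma Ad_Ad_inv (g : SL p q) (X : Mat p q) : Ad g (Ad g⁻¹ X) = X := by
  simpa using Ad_inv_Ad g⁻¹ X

lemma Ad_inv_image {g : SL p q} {A B : Set (Mat p q)} (h : Ad g '' A = B) : Ad g⁻¹ '' B = A := by
  rw [← h, Set.image_image]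
  simp [Ad_inv_Ad]

/-- Since `g` multiplies the form by `ε`, it carries `εδ`-positive subspaces to `δ`-positive ones.
-/
lemma exists_finrank_of_similitude {ε δ : ℝ} {g : SL p q} (hg : IsSimilitude ε g)
    {W W' : Submodule ℂ (E p q)} (hW : ∀ z ∈ W, (g : Mat p q) *ᵥ z ∈ W') {n : ℕ}
    (h : ∃ V ≤ W, Module.finrank ℂ V = n ∧ ∀ z ∈ V, z ≠ 0 → 0 < ε * δ * (herm p q z z).re) :
    ∃ V ≤ W', Module.finrank ℂ V = n ∧ ∀ z ∈ V, z ≠ 0 → 0 < δ * (herm p q z z).re := by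
  obtain ⟨V, hV, rfl, hpos⟩ := h
  refine ⟨V.map (Matrix.SpecialLinearGroup.toLin' g).toLinearMap, ?_,
    LinearEquiv.finrank_map_eq _ _, ?_⟩
  · rintro _ ⟨z, hz, rfl⟩
    exact hW z (hV hz)
  · rintro _ ⟨z, hz, rfl⟩ h0
    have h1 := hpos z hz (by rintro rfl; simp at h0)
    change 0 < δ * (herm p q ((g : Mat p q) *ᵥ z) ((g : Mat p q) *ᵥ z)).re
    rw [hg, Complex.re_ofReal_mul]
    linarith

lemma index_of_similitude {ε : ℝ} (hε : ε = 1 ∨ ε = -1) (δ : ℝ) {g : SL p q}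
    (hg : IsSimilitude ε g) {W W' : Submodule ℂ (E p q)}
    (hW : ∀ z, (g : Mat p q) *ᵥ z ∈ W' ↔ z ∈ W) : index δ W' = index (ε * δ) W := by
  have hεε : ε * ε = 1 := by rcases hε with rfl | rfl <;> norm_num
  unfold index
  congr 1
  ext n
  refine ⟨fun h => ?_, exists_finrank_of_similitude hg fun z => (hW z).2⟩
  refine exists_finrank_of_similitude (hg.inv hε) (W := W') (fun z hz => (hW _).1 ?_) ?_
  · rwa [coe_mulVec_inv_mulVec]
  · simpa [← mul_assoc, hεε] using h

/-- Transport of weights along conjugation. -/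
def transport {A B : Set (Mat p q)} {g : SL p q} (h : Ad g '' A = B) (χ : A → ℂ) : B → ℂ :=
  fun Y => χ ⟨Ad g⁻¹ Y, by rw [← Ad_inv_image h]; exact ⟨Y, Y.2, rfl⟩⟩

lemma transport_apply {A B : Set (Mat p q)} {g : SL p q} (h : Ad g '' A = B) (χ : A → ℂ) (X : A) :
    transport h χ ⟨Ad g X, h ▸ ⟨X, X.2, rfl⟩⟩ = χ X :=
  congrArg χ (Subtype.ext (Ad_inv_Ad g X))

lemma transport_injective {A B : Set (Mat p q)} {g : SL p q} (h : Ad g '' A = B) :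
    Function.Injective (transport h) := fun χ ψ hχψ => funext fun X => by
  rw [← transport_apply h χ, ← transport_apply h ψ, hχψ]

lemma mulVec_mem_jointEigenspace_transport {A B : Set (Mat p q)} {g : SL p q}
    (h : Ad g '' A = B) (χ : A → ℂ) (z : E p q) :
    (g : Mat p q) *ᵥ z ∈ jointEigenspace B (transport h χ) ↔ z ∈ jointEigenspace A χ := by
  rw [mem_jointEigenspace, mem_jointEigenspace]
  refine ⟨fun hz X => ?_, fun hz Y => ?_⟩
  · have h1 := hz ⟨Ad g X, h ▸ ⟨X, X.2, rfl⟩⟩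
    rw [transport_apply, Ad_mulVec, ← Matrix.mulVec_smul] at h1
    have h2 := congrArg (((g⁻¹ : SL p q) : Mat p q) *ᵥ ·) h1
    simpa only [inv_mulVec_coe_mulVec] using h2
  · obtain ⟨Y, hY⟩ := Y
    obtain ⟨X, hX, rfl⟩ := h.ge hY
    rw [transport_apply h χ ⟨X, hX⟩, Ad_mulVec, hz ⟨X, hX⟩, Matrix.mulVec_smul]

lemma finrank_transport {A B : Set (Mat p q)} {g : SL p q} (h : Ad g '' A = B) (χ : A → ℂ) :
    Module.finrank ℂ (jointEigenspace B (transport h χ))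
      = Module.finrank ℂ (jointEigenspace A χ) := by
  have : jointEigenspace B (transport h χ) =
      (jointEigenspace A χ).map (Matrix.SpecialLinearGroup.toLin' g).toLinearMap := by
    ext z
    rw [← coe_mulVec_inv_mulVec g z, mulVec_mem_jointEigenspace_transport]
    refine ⟨fun hz => ⟨_, hz, rfl⟩, ?_⟩
    rintro ⟨w, hw, hwz⟩
    change (g : Mat p q) *ᵥ w = _ at hwz
    rwa [← inv_mulVec_coe_mulVec g (_ *ᵥ z), ← hwz, inv_mulVec_coe_mulVec]
  rw [this, LinearEquiv.finrank_map_eq]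

variable {v₁ v₂ : LieSubalgebra ℝ (Mat p q)}

lemma bar_transport {g : SL p q} (h : Ad g '' toralPart v₁ = toralPart v₂)
    (χ : toralPart v₁ → ℂ) : bar (transport h χ) = transport h (bar χ) := rfl

lemma weightType_transport {ε : ℝ} (hε : ε = 1 ∨ ε = -1) {g : SL p q} (hg : IsSimilitude ε g)
    (h : Ad g '' toralPart v₁ = toralPart v₂) (χ : toralPart v₁ → ℂ) :
    weightType (transport h χ) = twist ε (weightType χ) := by
  have hi := fun δ : ℝ =>
    index_of_similitude hε δ hg (mulVec_mem_jointEigenspace_transport h χ)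
  by_cases hχ : bar χ = χ
  · rw [weightType, if_pos (by rw [bar_transport, hχ]), weightType, if_pos hχ, ← index_one,
      ← index_neg_one, ← index_one, ← index_neg_one, hi, hi]
    rcases hε with rfl | rfl
    · simp [twist]
    · norm_num [twist]
  · rw [weightType, if_neg (by rwa [bar_transport, (transport_injective h).eq_iff]), weightType,
      if_neg hχ, finrank_transport]
    unfold twist
    split_ifs <;> rfl

lemma weightType_bar (hv : IsMASA v) (χ : toralPart v → ℂ) :
    weightType (bar χ) = weightType χ := by
  by_cases h : bar χ = χ
  · rw [h]
  · rw [weightType, weightType, if_neg h, if_neg (by simpa [eq_comm] using h), finrank_jointEigenspace_bar hv]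

/-- The well-orders behind `weightsL` are unrelated for `v₁` and `v₂`, so a transported
representative may have to be replaced by its conjugate. The type is unchanged, and injectivity
survives because each orbit has a single representative. -/
lemma card_weightType_le {ε : ℝ} (hε : ε = 1 ∨ ε = -1) (hv₂ : IsMASA v₂)
    {g : SL p q} (hg : IsSimilitude ε g) (h : Ad g '' toralPart v₁ = toralPart v₂)
    (x : (ℕ × ℕ) ⊕ ℕ) : Nat.card {χ : weightsReps v₁ // weightType χ.1 = x}
      ≤ Nat.card {χ : weightsReps v₂ // weightType χ.1 = twist ε x} := by
  have := finite_weightsReps hv₂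
  have key : ∀ χ : {χ : weightsReps v₁ // weightType χ.1 = x},
      ∃ ψ : {χ : weightsReps v₂ // weightType χ.1 = twist ε x},
        ψ.1.1 = transport h χ.1.1 ∨ ψ.1.1 = transport h (bar χ.1.1) := by
    rintro ⟨⟨χ, hχ⟩, rfl⟩
    have hw : transport h χ ∈ weights v₂ := by
      rw [mem_weights_iff_finrank, finrank_transport]
      exact mem_weights_iff_finrank.1 (weightsReps_subset hχ)
    rcases mem_weightsReps_or hv₂ hw with h1 | h1
    · exact ⟨⟨⟨_, h1⟩, weightType_transport hε hg h χ⟩, Or.inl rfl⟩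
    · exact ⟨⟨⟨_, h1⟩, by rw [weightType_bar hv₂, weightType_transport hε hg h χ]⟩, Or.inr rfl⟩
  choose f hf using key
  refine Nat.card_le_card_of_injective f fun χ ψ hχψ => ?_
  have h1 : χ.1.1 = ψ.1.1 ∨ bar χ.1.1 = ψ.1.1 := by
    have hχ := hf χ
    rw [hχψ] at hχ
    rcases hχ with hχ | hχ <;> rcases hf ψ with hψ | hψ <;>
      have h2 := transport_injective h (hχ.symm.trans hψ)
    · exact Or.inl h2
    · exact Or.inr (by rw [h2, bar_bar])
    · exact Or.inr h2
    · exact Or.inl (by rw [← bar_bar χ.1.1, h2, bar_bar])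
  refine Subtype.ext (Subtype.ext ?_)
  rcases h1 with h1 | h1
  · exact h1
  · rw [← h1, bar_eq_of_mem_weightsReps χ.1.2 (h1 ▸ ψ.1.2)]

/-- Conjugation by a similitude transforms the `D`-invariant according to its sign. -/
lemma DInvariant_apply_of_similitude {ε : ℝ} (hε : ε = 1 ∨ ε = -1) (hv₁ : IsMASA v₁)
    (hv₂ : IsMASA v₂) {g : SL p q} (hg : IsSimilitude ε g)
    (h : Ad g '' toralPart v₁ = toralPart v₂) (x : (ℕ × ℕ) ⊕ ℕ) :
    DInvariant v₁ x = DInvariant v₂ (twist ε x) := by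
  rw [DInvariant_apply hv₁, DInvariant_apply hv₂]
  refine le_antisymm (card_weightType_le hε hv₂ hg h x) ?_
  have := card_weightType_le hε hv₁ (hg.inv hε) (Ad_inv_image h) (twist ε x)
  rwa [twist_twist] at this

end SUpq

/-! ### From equal invariants to a conjugating similitude -/

namespace SUpq

variable {p q : ℕ} {v₁ v₂ : LieSubalgebra ℝ (Mat p q)}

/-- A linear map that preserves the hermitian form up to sign can be scaled into `SL(E)`. -/
lemma exists_similitude_smul {ε : ℝ} (hε : ε = 1 ∨ ε = -1) (f : E p q →ₗ[ℂ] E p q)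
    (hm : Fintype.card (Fin p ⊕ Fin q) ≠ 0)
    (hf : ∀ z w, herm p q (f z) (f w) = ε * herm p q z w) :
    ∃ (g : SL p q) (c : ℂ), c ≠ 0 ∧ IsSimilitude ε g ∧ ∀ z, (g : Mat p q) *ᵥ z = c • f z := by
  set M : Mat p q := LinearMap.toMatrix' f with hM
  have hMf : ∀ z, M *ᵥ z = f z := fun z => by
    rw [← Matrix.toLin'_apply, hM, Matrix.toLin'_toMatrix']
  -- Taking determinants in `M* M = ε` gives `|det M| = 1`.
  have h1 : hermAdj M * M = (ε : ℂ) • (1 : Mat p q) := eq_of_herm_mulVec fun z w => by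
    rw [← Matrix.mulVec_mulVec, herm_hermAdj', hMf, hMf, hf, Matrix.smul_mulVec, Matrix.one_mulVec,
      herm_smul_left']
  have hH : (hermMatrix p q).det * (hermMatrix p q).det = 1 := by
    rw [← Matrix.det_mul, hermMatrix_mul_self, Matrix.det_one]
  have h2 : star M.det * M.det = (ε : ℂ) ^ Fintype.card (Fin p ⊕ Fin q) := by
    have h3 := congrArg Matrix.det h1
    rw [Matrix.det_mul, hermAdj, Matrix.det_mul, Matrix.det_mul, Matrix.det_conjTranspose,
      Matrix.det_smul, Matrix.det_one, mul_one] at h3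
    rw [← h3]
    linear_combination (-star M.det * M.det) * hH
  have hε1 : ‖(ε : ℂ)‖ = 1 := by rcases hε with rfl | rfl <;> simp
  have hnorm : ‖M.det‖ = 1 := by
    have h3 := congrArg norm h2
    rw [norm_mul, norm_star, norm_pow, hε1, one_pow, ← sq] at h3
    exact (pow_eq_one_iff_of_nonneg (norm_nonneg _) two_ne_zero).1 h3
  -- An `m`-th root of `(det M)⁻¹`; it has modulus 1, so scaling by it leaves the form unchanged.
  obtain ⟨c, hc⟩ := IsAlgClosed.exists_pow_nat_eq (M.det)⁻¹ (Nat.pos_of_ne_zero hm)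
  have hcn : ‖c‖ = 1 := by
    have h3 := congrArg norm hc
    rw [norm_pow, norm_inv, hnorm, inv_one] at h3
    exact (pow_eq_one_iff_of_nonneg (norm_nonneg _) hm).1 h3
  have hc0 : c ≠ 0 := by rintro rfl; simp at hcn
  have hd0 : M.det ≠ 0 := by intro h; simp [h] at hnorm
  refine ⟨⟨c • M, by rw [Matrix.det_smul, hc, inv_mul_cancel₀ hd0]⟩, c, hc0, fun z w => ?_,
    fun z => ?_⟩
  · change herm p q ((c • M) *ᵥ z) ((c • M) *ᵥ w) = _
    rw [Matrix.smul_mulVec, Matrix.smul_mulVec, herm_smul_left', herm_smul_right', hMf, hMf, hf,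
      ← mul_assoc, RCLike.star_def, Complex.mul_conj, Complex.normSq_eq_norm_sq, hcn]
    simp
  · change (c • M) *ᵥ z = _
    rw [Matrix.smul_mulVec, hMf]

lemma trace_Ad (g : SL p q) (X : Mat p q) : (Ad g X).trace = X.trace := by
  rw [Ad, Matrix.trace_mul_comm, ← Matrix.mul_assoc, ← Matrix.SpecialLinearGroup.coe_mul,
    inv_mul_cancel, Matrix.SpecialLinearGroup.coe_one, Matrix.one_mul]

lemma Ad_mem_su {ε : ℝ} {g : SL p q} (hg : IsSimilitude ε g) {X : Mat p q} (hX : X ∈ su p q) :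
    Ad g X ∈ su p q := by
  refine ⟨by rw [trace_Ad, hX.1], fun z w => ?_⟩
  rw [← coe_mulVec_inv_mulVec g z, ← coe_mulVec_inv_mulVec g w, Ad_mulVec, Ad_mulVec, hg, hg,
    ← mul_add, hX.2, mul_zero]

lemma exists_equiv_weightsReps (hv₁ : IsMASA v₁) (hv₂ : IsMASA v₂) {ε : ℝ}
    (h : ∀ x, DInvariant v₁ x = DInvariant v₂ (twist ε x)) :
    ∃ e : weightsReps v₁ ≃ weightsReps v₂, ∀ χ, twist ε (weightType (e χ).1) = weightType χ.1 := by
  have := finite_weightsReps hv₁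
  have := finite_weightsReps hv₂
  refine exists_equiv_of_card_fiber_eq (f := fun χ : weightsReps v₁ => weightType χ.1)
    (g := fun χ : weightsReps v₂ => twist ε (weightType χ.1)) fun x => ?_
  rw [← DInvariant_apply hv₁, h, DInvariant_apply hv₂]
  refine Nat.card_congr (Equiv.subtypeEquivRight fun χ => ⟨fun hχ => ?_, fun hχ => ?_⟩)
  · rw [hχ, twist_twist]
  · rw [← hχ, twist_twist]

/-- The tag `inl` or `inr` of a type records whether the index is fixed by the involution, and
`twist` keeps the tag. -/
lemma bar_eq_iff_of_weightType {ε : ℝ} {χ : toralPart v₁ → ℂ} {η : toralPart v₂ → ℂ}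
    (h : twist ε (weightType η) = weightType χ) : bar η = η ↔ bar χ = χ := by
  unfold twist weightType at h
  split_ifs at h <;> simp_all

lemma exists_isometry_of_weightType (hv₁ : IsMASA v₁) (hv₂ : IsMASA v₂) {ε : ℝ}
    (hε : ε = 1 ∨ ε = -1) {χ : toralPart v₁ → ℂ} {η : toralPart v₂ → ℂ}
    (h : twist ε (weightType η) = weightType χ) :
    ∃ ψ φ : E p q →ₗ[ℂ] E p q,
      (jointEigenspace (toralPart v₁) χ).map ψ = jointEigenspace (toralPart v₂) η ∧
      (jointEigenspace (toralPart v₁) (bar χ)).map φ = jointEigenspace (toralPart v₂) (bar η) ∧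
      (∀ z ∈ jointEigenspace (toralPart v₁) χ, ∀ w ∈ jointEigenspace (toralPart v₁) (bar χ),
        herm p q (ψ z) (φ w) = ε * herm p q z w) ∧ (bar χ = χ → ψ = φ) := by
  have hb := bar_eq_iff_of_weightType h
  have P1 := pairsLeft_jointEigenspace hv₁ χ
  have P2 := pairsLeft_jointEigenspace hv₂ η
  by_cases hχ : bar χ = χ
  · have hη := hb.2 hχ
    rw [hχ] at P1 ⊢
    rw [hη] at P2 ⊢
    rw [weightType, weightType, if_pos hχ, if_pos hη] at h
    obtain ⟨ψ, h1, h2⟩ := exists_isometry hε P1 P2 (by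
      rcases hε with rfl | rfl
      · simp only [twist, if_true, Sum.inl.injEq, Prod.mk.injEq] at h
        rintro δ (rfl | rfl)
        · simp [index_one, h.1]
        · simp [index_neg_one, h.2]
      · rw [twist, if_neg (by norm_num)] at h
        simp only [Sum.map_inl, Prod.swap_prod_mk, Sum.inl.injEq, Prod.mk.injEq] at h
        rintro δ (rfl | rfl)
        · simp [index_one, index_neg_one, h.1]
        · simp [index_one, index_neg_one, h.2])
    exact ⟨ψ, ψ, h1, h1, h2, fun _ => rfl⟩
  · have hη := mt hb.1 hχ
    rw [weightType, weightType, if_neg hχ, if_neg hη] at h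
    have hε0 : (ε : ℂ) ≠ 0 := by rcases hε with rfl | rfl <;> simp
    obtain ⟨ψ, φ, h1, h2, h3⟩ := exists_isometry_of_pairs hε0 P1
      (pairsLeft_jointEigenspace_bar hv₁ χ) P2 (pairsLeft_jointEigenspace_bar hv₂ η) (by
        unfold twist at h
        split_ifs at h <;> simpa using h.symm)
    exact ⟨ψ, φ, h1, h2, h3, fun h => absurd h hχ⟩

/-- If the `D`-invariants agree up to the twist by a sign, then there are a bijection of the joint
eigenspaces, compatible with the involution, and a linear map that realizes it and preserves the
hermitian form up to the sign. -/
lemma exists_isometry_of_DInvariant (hv₁ : IsMASA v₁) (hv₂ : IsMASA v₂) {ε : ℝ}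
    (hε : ε = 1 ∨ ε = -1) (h : ∀ x, DInvariant v₁ x = DInvariant v₂ (twist ε x)) :
    ∃ (σ : (toralPart v₁ → ℂ) → toralPart v₂ → ℂ) (f : E p q →ₗ[ℂ] E p q),
      (∀ η ∈ weights v₂, ∃ χ ∈ weights v₁, σ χ = η) ∧
      (∀ χ ∈ weights v₁, σ χ ∈ weights v₂ ∧
        (jointEigenspace (toralPart v₁) χ).map f = jointEigenspace (toralPart v₂) (σ χ)) ∧
      ∀ z w, herm p q (f z) (f w) = ε * herm p q z w := by
  classical
  obtain ⟨e, he⟩ := exists_equiv_weightsReps hv₁ hv₂ h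
  have hfix := fun r => bar_eq_iff_of_weightType (he r)
  choose ψ φ hψ hφ hψφ hK using fun r => exists_isometry_of_weightType hv₁ hv₂ hε (he r)
  -- Both `σ` and `Ψ` extend data on representatives along the involution. The default 0 never
  -- occurs on `weights v₁`.
  let σ : (toralPart v₁ → ℂ) → toralPart v₂ → ℂ := fun χ =>
    if h : χ ∈ weightsReps v₁ then (e ⟨χ, h⟩).1
    else if h : bar χ ∈ weightsReps v₁ then bar (e ⟨bar χ, h⟩).1 else 0
  let Ψ : (toralPart v₁ → ℂ) → E p q →ₗ[ℂ] E p q := fun χ =>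
    if h : χ ∈ weightsReps v₁ then ψ ⟨χ, h⟩
    else if h : bar χ ∈ weightsReps v₁ then φ ⟨bar χ, h⟩ else 0
  have hσ : ∀ r : weightsReps v₁, σ r.1 = (e r).1 := fun r => by simp [σ, r.2]
  have hΨ : ∀ r : weightsReps v₁, Ψ r.1 = ψ r := fun r => by simp [Ψ, r.2]
  have hσ' : ∀ r : weightsReps v₁, σ (bar r.1) = bar (e r).1 := fun r => by
    by_cases hr : bar r.1 ∈ weightsReps v₁
    · have h1 := bar_eq_of_mem_weightsReps r.2 hr
      rw [h1, hσ, (hfix r).2 h1]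
    · simp [σ, hr]
  have hΨ' : ∀ r : weightsReps v₁, Ψ (bar r.1) = φ r := fun r => by
    by_cases hr : bar r.1 ∈ weightsReps v₁
    · have h1 := bar_eq_of_mem_weightsReps r.2 hr
      rw [h1, hΨ, hK r h1]
    · simp [Ψ, hr]
  have hcases : ∀ χ ∈ weights v₁, ∃ r : weightsReps v₁, χ = r.1 ∨ χ = bar r.1 := fun χ hχ => by
    rcases mem_weightsReps_or hv₁ hχ with h1 | h1
    · exact ⟨⟨χ, h1⟩, Or.inl rfl⟩
    · exact ⟨⟨_, h1⟩, Or.inr (bar_bar χ).symm⟩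
  have hbar : ∀ χ ∈ weights v₁, σ (bar χ) = bar (σ χ) := fun χ hχ => by
    obtain ⟨r, rfl | rfl⟩ := hcases χ hχ
    · rw [hσ, hσ']
    · rw [bar_bar, hσ, hσ', bar_bar]
  have hinj' : ∀ r r' : weightsReps v₁, (e r).1 = bar (e r').1 → r.1 = bar r'.1 := fun r r' h1 => by
    have h2 := bar_eq_of_mem_weightsReps (e r').2 (h1 ▸ (e r).2)
    rw [h2] at h1
    rw [(hfix r').1 h2, e.injective (Subtype.ext h1)]
  have hinj : ∀ χ ∈ weights v₁, ∀ η ∈ weights v₁, σ χ = σ η → χ = η := fun χ hχ η hη h1 => by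
    obtain ⟨r, rfl | rfl⟩ := hcases χ hχ <;> obtain ⟨r', rfl | rfl⟩ := hcases η hη <;>
      simp only [hσ, hσ'] at h1
    · rw [e.injective (Subtype.ext h1)]
    · exact hinj' r r' h1
    · exact (hinj' r' r h1.symm).symm
    · have h2 := congrArg bar h1
      rw [bar_bar, bar_bar] at h2
      rw [e.injective (Subtype.ext h2)]
  obtain ⟨f, hf⟩ := exists_linearMap_of_iSupIndep (iSupIndep_jointEigenspace hv₁.isLieAbelian)
    (iSup_jointEigenspace hv₁.isLieAbelian) Ψ
  have hmap : ∀ χ ∈ weights v₁,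
      (jointEigenspace (toralPart v₁) χ).map f = jointEigenspace (toralPart v₂) (σ χ) := by
    intro χ hχ
    have h1 : (jointEigenspace (toralPart v₁) χ).map f
        = (jointEigenspace (toralPart v₁) χ).map (Ψ χ) :=
      SetLike.coe_injective (Set.image_congr (hf χ))
    rw [h1]
    obtain ⟨r, rfl | rfl⟩ := hcases χ hχ
    · rw [hσ, hΨ, hψ]
    · rw [hσ', hΨ', hφ]
  have hmem : ∀ χ ∈ weights v₁, ∀ z ∈ jointEigenspace (toralPart v₁) χ,
      f z ∈ jointEigenspace (toralPart v₂) (σ χ) := fun χ hχ z hz =>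
    hmap χ hχ ▸ Submodule.mem_map_of_mem hz
  refine ⟨σ, f, fun η hη => ?_, fun χ hχ => ⟨?_, hmap χ hχ⟩, fun z w => ?_⟩
  · rcases mem_weightsReps_or hv₂ hη with h1 | h1
    · refine ⟨(e.symm ⟨η, h1⟩).1, weightsReps_subset (e.symm ⟨η, h1⟩).2, ?_⟩
      rw [hσ, Equiv.apply_symm_apply]
    · refine ⟨bar (e.symm ⟨_, h1⟩).1,
        (bar_mem_weights hv₁).2 (weightsReps_subset (e.symm ⟨_, h1⟩).2), ?_⟩
      rw [hσ', Equiv.apply_symm_apply, bar_bar]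
  · obtain ⟨r, rfl | rfl⟩ := hcases χ hχ
    · rw [hσ]; exact weightsReps_subset (e r).2
    · rw [hσ', bar_mem_weights hv₂]; exact weightsReps_subset (e r).2
  · have hspan : Submodule.span ℂ (⋃ χ ∈ weights v₁,
        (jointEigenspace (toralPart v₁) χ : Set (E p q))) = ⊤ := by
      rw [eq_top_iff, ← iSup_jointEigenspace hv₁.isLieAbelian]
      refine iSup_le fun χ z hz => ?_
      by_cases hχ : χ ∈ weights v₁
      · exact Submodule.subset_span (Set.mem_iUnion₂.2 ⟨χ, hχ, hz⟩)
      · have h0 : jointEigenspace (toralPart v₁) χ = ⊥ := not_not.1 hχ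
        rw [h0, Submodule.mem_bot] at hz
        rw [hz]
        exact Submodule.zero_mem _
    refine herm_map_span (A := ⋃ χ ∈ weights v₁, (jointEigenspace (toralPart v₁) χ : Set (E p q)))
      (B := ⋃ χ ∈ weights v₁, (jointEigenspace (toralPart v₁) χ : Set (E p q)))
      (fun z hz w hw => ?_) (hspan ▸ Submodule.mem_top) (hspan ▸ Submodule.mem_top)
    obtain ⟨χ, hχ, hz⟩ := Set.mem_iUnion₂.1 hz
    obtain ⟨η, hη, hw⟩ := Set.mem_iUnion₂.1 hw
    -- Paired eigenspaces are compared through `hψφ`. For all others both sides vanish, because `σ`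
    -- is injective on weights and commutes with the involution.
    by_cases hηχ : η = bar χ
    · subst hηχ
      rw [hf _ z hz, hf _ w hw]
      obtain ⟨r, rfl | rfl⟩ := hcases χ hχ
      · rw [hΨ, hΨ']
        exact hψφ r z hz w hw
      · rw [bar_bar] at hw ⊢
        -- The same pair in reverse order: conjugate symmetry applies, since `ε` is real.
        rw [hΨ, hΨ', ← herm_star, hψφ r w hw z hz, star_mul', herm_star]
        simp
    · rw [herm_eq_zero_of_ne_bar hv₁.le_su hηχ hz hw, mul_zero]
      refine herm_eq_zero_of_ne_bar hv₂.le_su (fun h1 => hηχ ?_) (hmem χ hχ z hz) (hmem η hη w hw)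
      rw [← hbar χ hχ] at h1
      exact hinj η hη _ ((bar_mem_weights hv₁).2 hχ) h1

/-- If the `D`-invariants agree up to the twist by a sign, then the toral parts are conjugate under
a similitude with that sign. -/
lemma exists_similitude_of_DInvariant (hm : Fintype.card (Fin p ⊕ Fin q) ≠ 0) (hv₁ : IsMASA v₁)
    (hv₂ : IsMASA v₂) {ε : ℝ} (hε : ε = 1 ∨ ε = -1)
    (h : ∀ x, DInvariant v₁ x = DInvariant v₂ (twist ε x)) :
    ∃ g : SL p q, IsSimilitude ε g ∧ Ad g '' toralPart v₁ = toralPart v₂ := by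
  obtain ⟨σ, f, hsurj, hmap, hf⟩ := exists_isometry_of_DInvariant hv₁ hv₂ hε h
  obtain ⟨g, c, hc, hg, hgf⟩ := exists_similitude_smul hε f hm hf
  refine ⟨g, hg, Set.Subset.antisymm ?_ fun Y hY => ⟨Ad g⁻¹ Y, ?_, Ad_Ad_inv g Y⟩⟩
  · rintro _ ⟨X, hX, rfl⟩
    obtain ⟨hXsu, hXs⟩ := (mem_toralPart_iff hv₁).1 hX
    refine (mem_toralPart_iff hv₂).2 ⟨Ad_mem_su hg hXsu, fun η hη => ?_⟩
    obtain ⟨χ, hχ, rfl⟩ := hsurj η hη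
    obtain ⟨a, ha⟩ := hXs χ hχ
    refine ⟨a, fun z hz => ?_⟩
    rw [← (hmap χ hχ).2] at hz
    obtain ⟨w, hw, rfl⟩ := hz
    have h1 : f w = (g : Mat p q) *ᵥ (c⁻¹ • w) := by
      rw [hgf, map_smul, smul_smul, mul_inv_cancel₀ hc, one_smul]
    rw [h1, Ad_mulVec, ha _ (Submodule.smul_mem _ _ hw), Matrix.mulVec_smul]
  · obtain ⟨hYsu, hYs⟩ := (mem_toralPart_iff hv₂).1 hY
    refine (mem_toralPart_iff hv₁).2 ⟨Ad_mem_su (hg.inv hε) hYsu, fun χ hχ => ?_⟩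
    obtain ⟨a, ha⟩ := hYs _ (hmap χ hχ).1
    refine ⟨a, fun z hz => ?_⟩
    have h1 : (g : Mat p q) *ᵥ z ∈ jointEigenspace (toralPart v₂) (σ χ) := by
      rw [hgf, ← (hmap χ hχ).2]
      exact Submodule.smul_mem _ _ (Submodule.mem_map_of_mem hz)
    conv_lhs => rw [← inv_mulVec_coe_mulVec g z]
    rw [Ad_mulVec, ha _ h1, Matrix.mulVec_smul, inv_mulVec_coe_mulVec]

end SUpq

/-! ### The groups `SU` and `G`, and the final equivalences -/

namespace SUpq

variable {p q : ℕ} {v₁ v₂ : LieSubalgebra ℝ (Mat p q)}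

lemma Ad_mul (g : SL p q) (X Y : Mat p q) : Ad g (X * Y) = Ad g X * Ad g Y := by
  refine Matrix.mulVec_injective (funext fun z => ?_)
  rw [← coe_mulVec_inv_mulVec g z, ← Matrix.mulVec_mulVec, Ad_mulVec, Ad_mulVec, Ad_mulVec,
    Matrix.mulVec_mulVec _ X Y]

lemma Ad_lie (g : SL p q) (X Y : Mat p q) : ⁅Ad g X, Ad g Y⁆ = Ad g ⁅X, Y⁆ := by
  rw [Ring.lie_def, Ring.lie_def, ← Ad_mul, ← Ad_mul]
  simp only [Ad, Matrix.mul_sub, Matrix.sub_mul]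

@[simp] lemma Ad_zero (g : SL p q) : Ad g (0 : Mat p q) = 0 := by simp [Ad]

lemma Ad_lie_eq_zero {g : SL p q} {X Y : Mat p q} : ⁅Ad g X, Ad g Y⁆ = 0 ↔ ⁅X, Y⁆ = 0 := by
  rw [Ad_lie]
  refine ⟨fun h => ?_, fun h => by rw [h, Ad_zero]⟩
  rw [← Ad_inv_Ad g ⁅X, Y⁆, h, Ad_zero]

lemma Ad_image_suCentralizer {ε : ℝ} (hε : ε = 1 ∨ ε = -1) {g : SL p q} (hg : IsSimilitude ε g)
    (A : Set (Mat p q)) : Ad g '' suCentralizer A = suCentralizer (Ad g '' A) := by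
  refine Set.Subset.antisymm ?_ fun Y hY => ⟨Ad g⁻¹ Y, ?_, Ad_Ad_inv g Y⟩
  · rintro _ ⟨X, hX, rfl⟩
    refine ⟨Ad_mem_su hg hX.1, ?_⟩
    rintro _ ⟨Y, hY, rfl⟩
    exact Ad_lie_eq_zero.2 (hX.2 Y hY)
  · refine ⟨Ad_mem_su (hg.inv hε) hY.1, fun X hX => ?_⟩
    rw [← Ad_lie_eq_zero (g := g), Ad_Ad_inv]
    exact hY.2 _ ⟨X, hX, rfl⟩

lemma Ad_image_center (g : SL p q) (C : Set (Mat p q)) :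
    Ad g '' {X | X ∈ C ∧ ∀ Y ∈ C, ⁅X, Y⁆ = 0}
      = {X | X ∈ Ad g '' C ∧ ∀ Y ∈ Ad g '' C, ⁅X, Y⁆ = 0} := by
  ext X
  constructor
  · rintro ⟨X, ⟨hX, h⟩, rfl⟩
    refine ⟨⟨X, hX, rfl⟩, ?_⟩
    rintro _ ⟨Y, hY, rfl⟩
    exact Ad_lie_eq_zero.2 (h Y hY)
  · rintro ⟨⟨X, hX, rfl⟩, h⟩
    exact ⟨X, ⟨hX, fun Y hY => Ad_lie_eq_zero.1 (h _ ⟨Y, hY, rfl⟩)⟩, rfl⟩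

lemma mem_SU_iff {g : SL p q} : g ∈ SU p q ↔ IsSimilitude 1 g := by
  simp only [IsSimilitude, Complex.ofReal_one, one_mul]; rfl

lemma mem_G_iff {g : SL p q} : g ∈ G p q ↔ IsSimilitude 1 g ∨ IsSimilitude (-1) g := by
  have key : ∀ ε : ℝ, (∀ z : E p q, herm p q ((g : Mat p q) *ᵥ z) ((g : Mat p q) *ᵥ z)
      = ε * herm p q z z) ↔ IsSimilitude ε g := fun ε =>
    ⟨fun h => herm_eq_of_self (Matrix.toLin' (g : Mat p q)) (by simpa using h), fun h z => h z z⟩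
  rw [← key, ← key]
  simp only [Complex.ofReal_one, one_mul, Complex.ofReal_neg, neg_mul]
  rfl

lemma SU_le_G : SU p q ≤ G p q := fun _ hg => mem_G_iff.2 (Or.inl (mem_SU_iff.1 hg))

lemma IsSimilitude.mul {ε δ : ℝ} {g k : SL p q} (hg : IsSimilitude ε g) (hk : IsSimilitude δ k) :
    IsSimilitude (ε * δ) (g * k) := fun z w => by
  rw [Matrix.SpecialLinearGroup.coe_mul, ← Matrix.mulVec_mulVec, ← Matrix.mulVec_mulVec, hg, hk,
    Complex.ofReal_mul, mul_assoc]

lemma not_isSimilitude_neg_one (hp : 1 ≤ p) {g : SL p q} (h : IsSimilitude 1 g) :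
    ¬ IsSimilitude (-1) g := fun h' => by
  have h1 := (h (Pi.single (Sum.inl ⟨0, hp⟩) 1) (Pi.single (Sum.inl ⟨0, hp⟩) 1)).symm.trans
    (h' _ _)
  have h2 : herm p q (Pi.single (Sum.inl ⟨0, hp⟩) 1) (Pi.single (Sum.inl ⟨0, hp⟩) 1) = 1 := by
    simp [herm, Pi.single_apply]
  rw [h2] at h1
  norm_num at h1

/-- Exchanging the positive and the negative coordinates negates the form; a scalar corrects the
determinant. -/
lemma exists_isSimilitude_neg_one (hp : 1 ≤ p) : ∃ g : SL p p, IsSimilitude (-1) g := by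
  obtain ⟨g, -, -, hg, -⟩ := exists_similitude_smul (p := p) (q := p) (Or.inr rfl)
    (LinearMap.funLeft ℂ ℂ Sum.swap) (by simp; omega) fun z w => by
      simp [herm, LinearMap.funLeft_apply]
  exact ⟨g, hg⟩

/-- For `p = q` the group `SU(p,q)` has index two in `G`. -/
lemma relIndex_SU_G (hp : 1 ≤ p) : (SU p p).relIndex (G p p) = 2 := by
  obtain ⟨a, ha⟩ := exists_isSimilitude_neg_one hp
  refine Subgroup.relIndex_eq_two_iff.2 ⟨a, mem_G_iff.2 (Or.inr ha), fun b hb => ?_⟩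
  rw [mem_SU_iff, mem_SU_iff]
  rcases mem_G_iff.1 hb with hb | hb
  · refine Or.inr ⟨hb, fun h => not_isSimilitude_neg_one hp h ?_⟩
    simpa using hb.mul ha
  · refine Or.inl ⟨by simpa using hb.mul ha, fun h => not_isSimilitude_neg_one hp h hb⟩

lemma exists_similitude_iff (hm : Fintype.card (Fin p ⊕ Fin q) ≠ 0) (hv₁ : IsMASA v₁)
    (hv₂ : IsMASA v₂) {ε : ℝ} (hε : ε = 1 ∨ ε = -1) :
    (∃ g : SL p q, IsSimilitude ε g ∧ Ad g '' toralPart v₁ = toralPart v₂) ↔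
      ∀ x, DInvariant v₁ x = DInvariant v₂ (twist ε x) :=
  ⟨fun ⟨_, hg, h⟩ => DInvariant_apply_of_similitude hε hv₁ hv₂ hg h,
    exists_similitude_of_DInvariant hm hv₁ hv₂ hε⟩

lemma conjUnder_SU_toralPart_iff (hm : Fintype.card (Fin p ⊕ Fin q) ≠ 0) (hv₁ : IsMASA v₁)
    (hv₂ : IsMASA v₂) :
    ConjUnder (SU p q) (toralPart v₁) (toralPart v₂) ↔ DInvariant v₁ = DInvariant v₂ := by
  simp only [ConjUnder, mem_SU_iff, exists_similitude_iff hm hv₁ hv₂ (Or.inl rfl), twist, if_true,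
    Finsupp.ext_iff]

/-- The same `g` serves both ways: `Ad g` respects centralizers in `𝔤`, and taking the centre of the
centralizer returns the toral part. -/
lemma conjUnder_SU_suCentralizer_iff (hm : (p : ℂ) + q ≠ 0) (hv₁ : IsMASA v₁) (hv₂ : IsMASA v₂) :
    ConjUnder (SU p q) (suCentralizer (toralPart v₁)) (suCentralizer (toralPart v₂)) ↔
      ConjUnder (SU p q) (toralPart v₁) (toralPart v₂) := by
  have hc : ∀ {v : LieSubalgebra ℝ (Mat p q)}, IsMASA v → toralPart v =
      {X | X ∈ suCentralizer (toralPart v) ∧ ∀ Y ∈ suCentralizer (toralPart v), ⁅X, Y⁆ = 0} :=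
    fun hv => Set.ext fun X => mem_toralPart_iff_center hm hv
  constructor
  · rintro ⟨g, hg, h⟩
    refine ⟨g, hg, ?_⟩
    rw [hc hv₁, hc hv₂, Ad_image_center, h]
  · rintro ⟨g, hg, h⟩
    exact ⟨g, hg, by rw [Ad_image_suCentralizer (Or.inl rfl) (mem_SU_iff.1 hg), h]⟩

/-- An element of `G` has sign 1 or -1; the two signs account for the two alternatives. -/
lemma conjUnder_G_toralPart_iff (hm : Fintype.card (Fin p ⊕ Fin q) ≠ 0) (hv₁ : IsMASA v₁)
    (hv₂ : IsMASA v₂) :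
    ConjUnder (G p q) (toralPart v₁) (toralPart v₂) ↔
      DInvariant v₁ = DInvariant v₂ ∨ DInvariant v₁ = (DInvariant v₂).opp := by
  simp only [ConjUnder, mem_G_iff, or_and_right, exists_or,
    exists_similitude_iff hm hv₁ hv₂ (Or.inl rfl), exists_similitude_iff hm hv₁ hv₂ (Or.inr rfl),
    Finsupp.ext_iff, opp_apply]
  simp [twist]

end SUpq

theorem mainTheorem3 (p q : ℕ) (hp : 1 ≤ p) (hq : 1 ≤ q) (hpq : 3 ≤ p + q)
    (v₁ v₂ : LieSubalgebra ℝ (SUpq.Mat p q))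
    (hv₁ : SUpq.IsQualifyingMASA v₁) (hv₂ : SUpq.IsQualifyingMASA v₂) :
    (SUpq.ConjUnder (SUpq.SU p q) (SUpq.toralPart v₁) (SUpq.toralPart v₂) ↔
      SUpq.DInvariant v₁ = SUpq.DInvariant v₂) ∧
    (SUpq.ConjUnder (SUpq.SU p q) (SUpq.suCentralizer (SUpq.toralPart v₁))
        (SUpq.suCentralizer (SUpq.toralPart v₂)) ↔
      SUpq.DInvariant v₁ = SUpq.DInvariant v₂) ∧
    (p = q →
      SUpq.SU p q ≤ SUpq.G p q ∧ (SUpq.SU p q).relIndex (SUpq.G p q) = 2 ∧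
      (SUpq.ConjUnder (SUpq.G p q) (SUpq.toralPart v₁) (SUpq.toralPart v₂) ↔
        SUpq.DInvariant v₁ = SUpq.DInvariant v₂ ∨
          SUpq.DInvariant v₁ = (SUpq.DInvariant v₂).opp)) := by
  have hm : Fintype.card (Fin p ⊕ Fin q) ≠ 0 := by simp; omega
  have hm' : (p : ℂ) + q ≠ 0 := by norm_cast; omega
  have h1 := SUpq.conjUnder_SU_toralPart_iff hm hv₁.1 hv₂.1
  refine ⟨h1, (SUpq.conjUnder_SU_suCentralizer_iff hm' hv₁.1 hv₂.1).trans h1, fun h => ?_⟩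
  refine ⟨SUpq.SU_le_G, ?_, SUpq.conjUnder_G_toralPart_iff hm hv₁.1 hv₂.1⟩
  subst h
  exact SUpq.relIndex_SU_G hp
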